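/- Let $p$ be a prime, $q$ a power of $p$, and let $n_1\neq n_2$ be odd primes with $\gcd(n_1-1,n_2-1)=6$. Put $n=n_1n_2$, assume $\gcd(n,q)=1$, and let $e=(n_1-1)(n_2-1)/6$. Let $g$ be a common primitive root of $n_1$ and $n_2$, and let $u$ be an integer with $u\equiv g \pmod{n_1}$ and $u\equiv 1\pmod{n_2}$. For $0\le i\le 5$ let $W_i=\{g^su^i \bmod n: 0\le s\le e-1\}\subset\mathbb Z_n$, and put $D_0=W_0\cup W_2\cup W_4$, $D_1=W_1\cup W_3\cup W_5$, $P=\{n_1,2n_1,\dots,(n_2-1)n_1\}$ and $C_1=P\cup D_1$. The two-prime Whiteman generalized cyclotomic sequence of the first class (WGCS-I) of order $6$ is the sequence $\lambda^\infty=(\lambda_i)_{i\ge 0}$ over $\mathrm{GF}(q)$ of period $n$ with $\lambda_i=1$ if $i \bmod n\in C_1$ and $\lambda_i=0$ otherwise. Put $\Lambda(x)=\sum_{i\in C_1}x^i\in \mathrm{GF}(q)[x]$ (exponents taken in $\{0,\dots,n-1\}$) and $$g_\lambda(x)=\frac{x^n-1}{\gcd(x^n-1,\Lambda(x))},$$ with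 the monic greatest common divisor. Let $C_\lambda\subseteq \mathrm{GF}(q)^n$ be the cyclic code defined by $\lambda^\infty$, i.e. the code corresponding to the ideal generated by $g_\lambda$ in $\mathrm{GF}(q)[x]/(x^n-1)$ under $(c_0,\dots,c_{n-1})\mapsto\sum c_ix^i$. Let $L_\lambda$ be the linear span (linear complexity) of $\lambda^\infty$: the least $l$ for which there are $c_0,\dots,c_l\in\mathrm{GF}(q)$ with $c_0\ne0$ and $\sum_{i=0}^{l}c_i\lambda_{j-i}=0$ for all $j\ge l$. Let $\beta$ be a primitive $n$th root of unity in an extension field $K$ of $\mathrm{GF}(q)$, put $d_i(x)=\prod_{j\in D_i}(x-\beta^j)\in K[x]$ for $i=0,1$, and let $$\Delta_1=\tfrac{n_1+1}{2} \bmod p,\qquad \Delta_2=\tfrac{n_2-1}{2}\bmod p,\qquad \Delta=\tfrac{(n_1+1)(n_2-1)}{2}\bmod p.$$ Theorem. The code $C_\lambda$ is cyclic, its generator polynomial is $g_\lambda(x)$, its dimension is $n-\deg g_\lambda(x)$, and the following holds. (1) Suppose that $n\equiv 7\pmod{12}$ and $\frac{n+1}{4}\not\equiv0\pmod p$, or that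 $n\equiv1\pmod{12}$ and $\frac{n-1}{4}\not\equiv 0\pmod p$. Then - if $\Delta_1\ne0$, $\Delta_2\neq0$, $\Delta\ne0$: $g_\lambda(x)=x^n-1$ and $L_\lambda=n$; - if $\Delta_1\ne0$, $\Delta_2\neq0$, $\Delta=0$: $g_\lambda(x)=\frac{x^n-1}{x-1}$ and $L_\lambda=n-1$; - if $\Delta_1=0$, $\Delta_2\ne0$: $g_\lambda(x)=\frac{x^n-1}{x^{n_2}-1}$ and $L_\lambda=n-n_2$; - if $\Delta_1\ne0$, $\Delta_2=0$: $g_\lambda(x)=\frac{x^n-1}{x^{n_1}-1}$ and $L_\lambda=n-n_1$; - if $\Delta_1=\Delta_2=0$: $g_\lambda(x)=\frac{(x^n-1)(x-1)}{(x^{n_1}-1)(x^{n_2}-1)}$ and $L_\lambda=n-(n_1+n_2-1)$. (2) Suppose that $n\equiv 7\pmod{12}$ and $\frac{n+1}{4}\equiv0\pmod p$, or that $n\equiv1\pmod{12}$ and $\frac{n-1}{4}\equiv 0\pmod p$. Then $q \bmod n\in D_0$, the polynomials $d_0,d_1$ have coefficients in $\mathrm{GF}(q)$, and $\Lambda(\beta)\in\{0,-1\}$.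 Put $d_*(x)=d_0(x)$ if $\Lambda(\beta)=0$ and $d_*(x)=d_1(x)$ if $\Lambda(\beta)=-1$. Then - if $\Delta_1\ne0$, $\Delta_2\neq0$, $\Delta\ne0$: $g_\lambda(x)=\frac{x^n-1}{d_*(x)}$ and $L_\lambda=n-\frac{(n_1-1)(n_2-1)}{2}$; - if $\Delta_1\ne0$, $\Delta_2\neq0$, $\Delta=0$: $g_\lambda(x)=\frac{x^n-1}{(x-1)d_*(x)}$ and $L_\lambda=n-\frac{(n_1-1)(n_2-1)+2}{2}$; - if $\Delta_1=0$, $\Delta_2\ne0$: $g_\lambda(x)=\frac{x^n-1}{(x^{n_2}-1)d_*(x)}$ and $L_\lambda=n-\frac{(n_1+1)(n_2-1)+2}{2}$; - if $\Delta_1\ne0$, $\Delta_2=0$: $g_\lambda(x)=\frac{x^n-1}{(x^{n_1}-1)d_*(x)}$ and $L_\lambda=n-\frac{(n_1-1)(n_2+1)+2}{2}$; - if $\Delta_1=\Delta_2=0$: $g_\lambda(x)=\frac{(x^n-1)(x-1)}{(x^{n_1}-1)(x^{n_2}-1)d_*(x)}$ and $L_\lambda=n-\frac{(n_1+1)(n_2+1)-2}{2}$.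 -/

import Mathlib

open Polynomial

/-- The integer `a` is a primitive root modulo `n`: it is coprime to `n` and its multiplicative
order modulo `n` is `φ(n)`. -/
def IsPrimitiveRootMod (a : ℤ) (n : ℕ) : Prop :=
  IsCoprime a (n : ℤ) ∧ orderOf (a : ZMod n) = Nat.totient n

namespace Whiteman

/-- The order `d = gcd(n₁ - 1, n₂ - 1)` of the generalized cyclotomy. -/
def order (n₁ n₂ : ℕ) : ℕ := Nat.gcd (n₁ - 1) (n₂ - 1)

/-- Whiteman's generalized cyclotomic class
`W_i = {g^s u^i mod n₁n₂ : s = 0, …, e - 1}`, where `e = (n₁ - 1)(n₂ - 1) / d`. -/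
def W (n₁ n₂ : ℕ) (g u : ℤ) (i : ℕ) : Finset (ZMod (n₁ * n₂)) :=
  (Finset.range ((n₁ - 1) * (n₂ - 1) / order n₁ n₂)).image
    fun s => (g : ZMod (n₁ * n₂)) ^ s * (u : ZMod (n₁ * n₂)) ^ i

/-- `P = {n₁, 2n₁, …, (n₂ - 1)n₁}`. -/
def P (n₁ n₂ : ℕ) : Finset (ZMod (n₁ * n₂)) :=
  (Finset.Icc 1 (n₂ - 1)).image fun k => ((k * n₁ : ℕ) : ZMod (n₁ * n₂))

/-- `D₀ = ⋃_{i < d/2} W_{2i}`; for `d = 6` this is `W₀ ∪ W₂ ∪ W₄`. -/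
def D₀ (n₁ n₂ : ℕ) (g u : ℤ) : Finset (ZMod (n₁ * n₂)) :=
  (Finset.range (order n₁ n₂ / 2)).biUnion fun i => W n₁ n₂ g u (2 * i)

/-- `D₁ = ⋃_{i < d/2} W_{2i+1}`; for `d = 6` this is `W₁ ∪ W₃ ∪ W₅`. -/
def D₁ (n₁ n₂ : ℕ) (g u : ℤ) : Finset (ZMod (n₁ * n₂)) :=
  (Finset.range (order n₁ n₂ / 2)).biUnion fun i => W n₁ n₂ g u (2 * i + 1)

/-- The characteristic set `C₁ = P ∪ ⋃_{i < d/2} W_{2i+1}` of the sequence. -/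
def C₁ (n₁ n₂ : ℕ) (g u : ℤ) : Finset (ZMod (n₁ * n₂)) :=
  P n₁ n₂ ∪ D₁ n₁ n₂ g u

/-- The first class two-prime Whiteman generalized cyclotomic sequence (WGCS-I), as a sequence
over `F` of period `n₁n₂`: `1` on `C₁` and `0` on its complement in `ℤ/n₁n₂`,
which is `{0} ∪ {n₂, …, (n₁ - 1)n₂} ∪ D₀`. -/
def seq (F : Type*) [Field F] (n₁ n₂ : ℕ) (g u : ℤ) (j : ℕ) : F :=
  if (j : ZMod (n₁ * n₂)) ∈ C₁ n₁ n₂ g u then 1 else 0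

/-- `Λ(x) = ∑_{i ∈ C₁} x^i`. -/
noncomputable def Lam (F : Type*) [Field F] (n₁ n₂ : ℕ) (g u : ℤ) : F[X] :=
  ∑ i ∈ C₁ n₁ n₂ g u, X ^ i.val

/-- `∏_{j ∈ S} (x - β^j)`, for a set `S` of residues modulo `n`. -/
noncomputable def rootPoly {K : Type*} [Field K] {n : ℕ} (β : K) (S : Finset (ZMod n)) : K[X] :=
  ∏ j ∈ S, (X - C (β ^ j.val))

end Whiteman

/-- `l` is a recurrence length of `s`: there is `f = c₀ + c₁x + ⋯` of degree at most `l` with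
`c₀ ≠ 0` and `c₀ s_j + c₁ s_{j-1} + ⋯ + c_l s_{j-l} = 0` for all `j ≥ l`. -/
def IsRecurrenceLength {F : Type*} [Field F] (s : ℕ → F) (l : ℕ) : Prop :=
  ∃ f : F[X], f.natDegree ≤ l ∧ f.coeff 0 ≠ 0 ∧
    ∀ j, l ≤ j → ∑ i ∈ Finset.range (l + 1), f.coeff i * s (j - i) = 0

/-- `L` is the linear span (linear complexity) of `s`: the least recurrence length. -/
def IsLinearSpan {F : Type*} [Field F] (s : ℕ → F) (L : ℕ) : Prop :=
  IsLeast {l | IsRecurrenceLength s l} L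

open scoped Classical in
/-- The monic greatest common divisor of two polynomials over a field. -/
noncomputable def monicGcd {F : Type*} [Field F] (a b : F[X]) : F[X] :=
  normalize (EuclideanDomain.gcd a b)

/-- `(x^n - 1) / gcd(x^n - 1, S(x))` -/
noncomputable def genPoly {F : Type*} [Field F] (n : ℕ) (S : F[X]) : F[X] :=
  (X ^ n - 1) / monicGcd (X ^ n - 1) S

/-- `g` is the exact quotient `a / b` (with `b ≠ 0`). -/
def IsQuotient {K : Type*} [Field K] (g a b : K[X]) : Prop :=
  b ≠ 0 ∧ g * b = a

/-- The correspondence `F^n → F[x]/(x^n - 1)`,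
`(c₀, …, c_{n-1}) ↦ c₀ + c₁x + ⋯ + c_{n-1}x^{n-1}`. -/
noncomputable def wordMap (F : Type*) [Field F] (n : ℕ) :
    (Fin n → F) →ₗ[F] F[X] ⧸ Ideal.span {(X ^ n - 1 : F[X])} :=
  Fintype.linearCombination F fun i : Fin n =>
    Ideal.Quotient.mk (Ideal.span {(X ^ n - 1 : F[X])}) (X ^ (i : ℕ))

/-- The linear code of length `n` that corresponds to the ideal generated by `g(x)` in
`F[x]/(x^n - 1)`. -/
noncomputable def codeOf {F : Type*} [Field F] (n : ℕ) (g : F[X]) : Submodule F (Fin n → F) :=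
  ((Ideal.span {Ideal.Quotient.mk (Ideal.span {(X ^ n - 1 : F[X])}) g}).restrictScalars F).comap
    (wordMap F n)

/-- `C` is closed under the cyclic shift `(c₀, …, c_{n-1}) ↦ (c_{n-1}, c₀, …, c_{n-2})`. -/
def IsCyclicCode {F : Type*} [Field F] {n : ℕ} (C : Submodule F (Fin n → F)) : Prop :=
  ∀ c ∈ C, (fun i => c ((finRotate n).symm i)) ∈ C

/-- `g` is the generator polynomial of `C`: it is monic, divides `x^n - 1`, and generates the
ideal of `F[x]/(x^n - 1)` that corresponds to `C`. -/
def IsGeneratorPolynomial {F : Type*} [Field F] {n : ℕ} (C : Submodule F (Fin n → F))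
    (g : F[X]) : Prop :=
  g.Monic ∧ g ∣ X ^ n - 1 ∧ C = codeOf n g

/-- The cyclic code defined by the sequence `s` of period `n`: the code generated by
`(x^n - 1) / gcd(x^n - 1, S(x))`, where `S(x) = s₀ + s₁x + ⋯ + s_{n-1}x^{n-1}`. -/
noncomputable def codeOfSeq {F : Type*} [Field F] (n : ℕ) (s : ℕ → F) : Submodule F (Fin n → F) :=
  codeOf n (genPoly n (∑ i ∈ Finset.range n, C (s i) * X ^ i))

open Polynomial

/-! Since `x^n - 1` is separable with roots `β^k`, its gcd with `Λ` is the product of the `x - β^k`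
with `Λ(β^k) = 0`. Hence everything reduces to the values `Λ(β^k)` (`map_genPoly_mul_rootPoly`).

The sets `D₀` and `D₁` are the fibres over `1` and `-1` of the Jacobi symbol modulo `n` (`mem_D₀`,
`mem_D₁`). The residues split into `{0}`, `P`, the nonzero multiples of `n₂`, `D₀` and `D₁`, and
`Λ(β^k)` is constant on each. On the non-units the quadratic Gauss sum vanishes, and inclusion and
exclusion gives the values `Δ`, `-Δ₁` and `Δ₂`. On `D₀` and `D₁` the values are `-η₀` and `-η₁`,
where `η_i` is the Gaussian period `∑_{x ∈ D_i} β^x`. These satisfy `η₀ + η₁ = 1` and, by the square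
of the Gauss sum, `4η₀η₁ = 1 - χ₄(n)n`. So either neither period vanishes, or `η₀η₁ = 0` and exactly
one does; this is the split into (1) and (2).

The period formulas come with a factor `2`, which is useless in characteristic `2`. They are
therefore solved over `ℂ`, and the resulting integral relations are carried to `K` by the cyclotomic
polynomial (`aeval_eq_zero_of_complex`).

In case (2) `Λ(β)` is `0` or `-1`, hence fixed by Frobenius; this forces `q ∈ D₀`, and then `d₀` and
`d₁` are Frobenius-stable. The linear span is `deg g_λ` because the generating series of the
sequence is `Λ/(1 - x^n)` (`isLinearSpan_natDegree_genPoly`). -/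

theorem IsQuotient.natDegree_add {K : Type*} [Field K] {g a b : K[X]} (h : IsQuotient g a b)
    (ha : a ≠ 0) : g.natDegree + b.natDegree = a.natDegree := by
  have hg : g ≠ 0 := by
    rintro rfl
    exact ha (by rw [← h.2, zero_mul])
  rw [← h.2, natDegree_mul hg h.1]

/-! ### The monic gcd and the quotient `(x^n - 1)/gcd` -/

section Gcd

variable {F : Type*} [Field F]

theorem monicGcd_dvd_left (a b : F[X]) : monicGcd a b ∣ a := by
  classical
  unfold monicGcd
  exact normalize_dvd_iff.2 (EuclideanDomain.gcd_dvd_left a b)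

theorem monicGcd_dvd_right (a b : F[X]) : monicGcd a b ∣ b := by
  classical
  unfold monicGcd
  exact normalize_dvd_iff.2 (EuclideanDomain.gcd_dvd_right a b)

theorem monicGcd_monic {a : F[X]} (ha : a ≠ 0) (b : F[X]) : (monicGcd a b).Monic := by
  classical
  unfold monicGcd
  exact monic_normalize fun h => ha (EuclideanDomain.gcd_eq_zero_iff.1 h).1

theorem exists_monicGcd_eq (a b : F[X]) : ∃ r s : F[X], monicGcd a b = a * r + b * s := by
  classical
  have h : monicGcd a b ∣ EuclideanDomain.gcd a b := by
    unfold monicGcd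
    exact normalize_dvd_iff.2 dvd_rfl
  have h' : EuclideanDomain.gcd a b ∣ monicGcd a b := by
    unfold monicGcd
    exact dvd_normalize_iff.2 dvd_rfl
  obtain ⟨c, hc⟩ := h'
  refine ⟨EuclideanDomain.gcdA a b * c, EuclideanDomain.gcdB a b * c, ?_⟩
  rw [hc, EuclideanDomain.gcd_eq_gcd_ab]
  ring

theorem X_pow_sub_one_ne_zero {n : ℕ} (hn : n ≠ 0) : (X ^ n - 1 : F[X]) ≠ 0 :=
  (monic_X_pow_sub_C (1 : F) hn).ne_zero

theorem genPoly_mul_monicGcd (n : ℕ) (S : F[X]) :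
    genPoly n S * monicGcd (X ^ n - 1) S = X ^ n - 1 := by
  rw [mul_comm]
  by_cases h : monicGcd (X ^ n - 1) S = 0
  · have := monicGcd_dvd_left (X ^ n - 1) S
    rw [h] at this ⊢
    rw [zero_mul, zero_dvd_iff.1 this]
  · exact EuclideanDomain.mul_div_cancel' h (monicGcd_dvd_left _ _)

theorem genPoly_dvd (n : ℕ) (S : F[X]) : genPoly n S ∣ X ^ n - 1 :=
  ⟨_, (genPoly_mul_monicGcd n S).symm⟩

theorem genPoly_monic {n : ℕ} (hn : n ≠ 0) (S : F[X]) : (genPoly n S).Monic := by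
  refine (monicGcd_monic (X_pow_sub_one_ne_zero hn) S).of_mul_monic_right ?_
  rw [genPoly_mul_monicGcd]
  exact monic_X_pow_sub_C (1 : F) hn

/-- By Bézout, `x^n - 1` also divides `f` times the gcd, and the gcd cancels. This is the minimality
behind the lower bound for the linear span. -/
theorem genPoly_dvd_of_dvd_mul {n : ℕ} (hn : n ≠ 0) {S f : F[X]} (h : X ^ n - 1 ∣ f * S) :
    genPoly n S ∣ f := by
  obtain ⟨r, s, hrs⟩ := exists_monicGcd_eq (X ^ n - 1) S
  have h1 : X ^ n - 1 ∣ f * monicGcd (X ^ n - 1) S := by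
    rw [hrs, mul_add]
    refine dvd_add ⟨f * r, by ring⟩ ?_
    rw [← mul_assoc]
    exact h.mul_right s
  nth_rw 1 [← genPoly_mul_monicGcd n S] at h1
  exact (mul_dvd_mul_iff_right (monicGcd_monic (X_pow_sub_one_ne_zero hn) S).ne_zero).1 h1

end Gcd

/-! ### Cyclic codes as ideals -/

section Code

variable {F : Type*} [Field F]

/-- The polynomial `c₀ + c₁x + ⋯ + c_{n-1}x^{n-1}` of a word. -/
noncomputable def wordPoly (F : Type*) [Field F] (n : ℕ) : (Fin n → F) →ₗ[F] F[X] :=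
  Fintype.linearCombination F fun i : Fin n => (X ^ (i : ℕ) : F[X])

theorem wordPoly_apply {n : ℕ} (c : Fin n → F) :
    wordPoly F n c = ∑ i : Fin n, C (c i) * X ^ (i : ℕ) := by
  simp [wordPoly, Fintype.linearCombination_apply, smul_eq_C_mul]

theorem wordMap_apply {n : ℕ} (c : Fin n → F) :
    wordMap F n c = Ideal.Quotient.mk (Ideal.span {(X ^ n - 1 : F[X])}) (wordPoly F n c) := by
  rw [wordPoly, wordMap, Fintype.linearCombination_apply, Fintype.linearCombination_apply, map_sum]
  rfl

theorem mem_codeOf {n : ℕ} {g : F[X]} (hg : g ∣ X ^ n - 1) (c : Fin n → F) :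
    c ∈ codeOf n g ↔ g ∣ wordPoly F n c := by
  rw [codeOf, Submodule.mem_comap, Submodule.restrictScalars_mem, wordMap_apply,
    Ideal.mem_span_singleton]
  constructor
  · rintro ⟨r, hr⟩
    obtain ⟨r, rfl⟩ := Ideal.Quotient.mk_surjective r
    rw [← map_mul, Ideal.Quotient.eq, Ideal.mem_span_singleton] at hr
    have := dvd_add (hg.trans hr) (dvd_mul_right g r)
    simpa using this
  · rintro ⟨r, hr⟩
    exact ⟨Ideal.Quotient.mk _ r, by rw [hr, map_mul]⟩

/-- The shift is multiplication by `x` followed by subtraction of `c_{n-1}(x^n - 1)`; both keep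
divisibility by `g`. -/
theorem isCyclicCode_codeOf {n : ℕ} {g : F[X]} (hg : g ∣ X ^ n - 1) :
    IsCyclicCode (codeOf n g) := by
  intro c hc
  rcases n with _ | m
  · convert hc using 1
  rw [mem_codeOf hg] at hc ⊢
  have key : wordPoly F (m + 1) (fun i => c ((finRotate (m + 1)).symm i)) =
      X * wordPoly F (m + 1) c - C (c (Fin.last m)) * (X ^ (m + 1) - 1) := by
    rw [wordPoly_apply, wordPoly_apply,
      ← Equiv.sum_comp (finRotate (m + 1))]
    simp only [Equiv.symm_apply_apply]
    rw [Fin.sum_univ_castSucc, Fin.sum_univ_castSucc]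
    simp only [finRotate_apply]
    rw [mul_add, Finset.mul_sum]
    have : ∀ i : Fin m, ((i.castSucc + 1 : Fin (m + 1)) : ℕ) = i + 1 := by
      intro i
      rw [Fin.coeSucc_eq_succ, Fin.val_succ]
    simp only [this, Fin.val_castSucc, Fin.val_last]
    have h2 : ∀ i : Fin m, C (c i.castSucc) * X ^ ((i : ℕ) + 1) =
        X * (C (c i.castSucc) * X ^ (i : ℕ)) := by
      intro i
      ring
    rw [Finset.sum_congr rfl fun i _ => h2 i]
    simp
    ring
  rw [key]
  exact dvd_sub (hc.mul_left _) (hg.mul_left _)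

/-- The code is the kernel of `F^n → F[x]/(g)`. This map is onto because remainders modulo `g` have
degree below `n`, and its target has dimension `deg g`. -/
theorem finrank_codeOf {n : ℕ} (hn : n ≠ 0) {g : F[X]} (hg : g ∣ X ^ n - 1) :
    Module.finrank F (codeOf n g) + g.natDegree = n := by
  have hg0 : g ≠ 0 := by
    rintro rfl
    exact X_pow_sub_one_ne_zero hn (zero_dvd_iff.1 hg)
  have hdeg : g.natDegree ≤ n := by
    have := natDegree_le_of_dvd hg (X_pow_sub_one_ne_zero hn)
    rwa [← C_1, natDegree_X_pow_sub_C] at this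
  let I := Ideal.span {g}
  let φ : (Fin n → F) →ₗ[F] F[X] ⧸ I := (Ideal.Quotient.mkₐ F I).toLinearMap.comp (wordPoly F n)
  have hker : LinearMap.ker φ = codeOf n g := by
    ext c
    rw [LinearMap.mem_ker, mem_codeOf hg]
    change Ideal.Quotient.mk I (wordPoly F n c) = 0 ↔ _
    rw [Ideal.Quotient.eq_zero_iff_mem, Ideal.mem_span_singleton]
  have hsurj : Function.Surjective φ := by
    intro y
    obtain ⟨f, rfl⟩ := Ideal.Quotient.mk_surjective y
    refine ⟨fun i => (f % g).coeff i, ?_⟩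
    change Ideal.Quotient.mk I (wordPoly F n _) = _
    have h1 : wordPoly F n (fun i => (f % g).coeff i) = f % g := by
      rw [wordPoly_apply, Fin.sum_univ_eq_sum_range (fun i => C ((f % g).coeff i) * X ^ i) n]
      symm
      refine as_sum_range_C_mul_X_pow' _ ?_
      by_cases h0 : g.natDegree = 0
      · have hu : IsUnit g := isUnit_iff_degree_eq_zero.2 (by rw [degree_eq_natDegree hg0, h0]; rfl)
        rw [EuclideanDomain.mod_eq_zero.2 hu.dvd, natDegree_zero]
        omega
      · exact (natDegree_mod_lt f h0).trans_le hdeg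
    rw [h1, Ideal.Quotient.eq, Ideal.mem_span_singleton]
    refine ⟨-(f / g), ?_⟩
    have := EuclideanDomain.mod_add_div f g
    linear_combination this
  have h := LinearMap.finrank_range_add_finrank_ker φ
  rw [hker, LinearMap.range_eq_top.2 hsurj, finrank_top, Module.finrank_fin_fun,
    finrank_quotient_span_eq_natDegree] at h
  omega

end Code

/-! ### Linear span through generating series -/

section LinearSpan

variable {F : Type*} [Field F]

theorem coeff_mul_mk {f : F[X]} {l : ℕ} (hf : f.natDegree ≤ l) (s : ℕ → F) {j : ℕ} (hj : l ≤ j) :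
    PowerSeries.coeff j ((f : PowerSeries F) * PowerSeries.mk s) =
      ∑ i ∈ Finset.range (l + 1), f.coeff i * s (j - i) := by
  rw [PowerSeries.coeff_mul, Finset.Nat.sum_antidiagonal_eq_sum_range_succ_mk]
  simp only [Polynomial.coeff_coe, PowerSeries.coeff_mk]
  symm
  refine Finset.sum_subset (Finset.range_mono (by omega)) fun i _ hi => ?_
  rw [coeff_eq_zero_of_natDegree_lt, zero_mul]
  simp at hi
  omega

theorem mk_mul_one_sub_X_pow {n : ℕ} {s : ℕ → F} (hs : ∀ j, s (j + n) = s j) :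
    PowerSeries.mk s * (1 - PowerSeries.X ^ n) =
      ((∑ i ∈ Finset.range n, C (s i) * X ^ i : F[X]) : PowerSeries F) := by
  ext j
  rw [mul_sub, mul_one, map_sub, PowerSeries.coeff_mul_X_pow', Polynomial.coeff_coe,
    finsetSum_coeff, PowerSeries.coeff_mk]
  simp only [coeff_C_mul, coeff_X_pow, mul_ite, mul_one, mul_zero, Finset.sum_ite_eq,
    Finset.mem_range]
  split_ifs with h1 h2 h2
  · omega
  · rw [PowerSeries.coeff_mk, ← hs (j - n), Nat.sub_add_cancel h1, sub_self]
  · rw [sub_zero]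
  · omega

/-- A polynomial `f` of degree at most `l` gives a recurrence of length `l` when `f` times the
series of `s` has no coefficients from `l` on. As that series is `S/(1 - x^n)`, this forces `x^n - 1
∣ fS`, hence `genPoly n S ∣ f`. Conversely, `genPoly n S` times the series is `-S/gcd`, of degree
below `n - deg gcd`. -/
theorem isLinearSpan_natDegree_genPoly {n : ℕ} (hn : n ≠ 0) {s : ℕ → F}
    (hs : ∀ j, s (j + n) = s j) :
    IsLinearSpan s (genPoly n (∑ i ∈ Finset.range n, C (s i) * X ^ i)).natDegree := by
  set S : F[X] := ∑ i ∈ Finset.range n, C (s i) * X ^ i with hS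
  have hmk := mk_mul_one_sub_X_pow hs
  rw [← hS] at hmk
  have hmon := genPoly_monic hn S
  constructor
  · refine ⟨genPoly n S, le_rfl, ?_, ?_⟩
    · intro h0
      have h1 := congrArg (fun f => coeff f 0) (genPoly_mul_monicGcd n S)
      simp [mul_coeff_zero, h0, coeff_X_pow, hn.symm] at h1
    · intro j hj
      rw [← coeff_mul_mk le_rfl s hj]
      obtain ⟨T, hT⟩ := monicGcd_dvd_right (X ^ n - 1) S
      have h1 : ((genPoly n S : F[X]) : PowerSeries F) * PowerSeries.mk s =
          ((-T : F[X]) : PowerSeries F) := by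
        have hne : (1 - PowerSeries.X ^ n : PowerSeries F) ≠ 0 := by
          intro h
          have := congrArg (PowerSeries.coeff 0) h
          simp [hn] at this
        refine mul_right_cancel₀ hne ?_
        rw [mul_assoc, hmk, ← Polynomial.coe_mul]
        have h2 : (1 - PowerSeries.X ^ n : PowerSeries F) = ((1 - X ^ n : F[X]) : PowerSeries F) := by
          simp
        rw [h2, ← Polynomial.coe_mul]
        congr 1
        have h3 := genPoly_mul_monicGcd n S
        linear_combination genPoly n S * hT + T * h3
      rw [h1, Polynomial.coeff_coe, coeff_neg, neg_eq_zero]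
      by_cases hT0 : T = 0
      · rw [hT0, coeff_zero]
      apply coeff_eq_zero_of_natDegree_lt
      refine lt_of_lt_of_le ?_ hj
      have hG := monicGcd_monic (X_pow_sub_one_ne_zero hn) S
      have hd1 := congrArg natDegree (genPoly_mul_monicGcd n S)
      rw [natDegree_mul hmon.ne_zero hG.ne_zero, ← C_1, natDegree_X_pow_sub_C, C_1] at hd1
      have hd2 : S.natDegree < n := by
        refine lt_of_le_of_lt (natDegree_sum_le_of_forall_le (n := n - 1) _ _ fun i hi => ?_)
          (by omega)
        refine (natDegree_C_mul_X_pow_le _ _).trans ?_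
        rw [Finset.mem_range] at hi
        omega
      rw [hT, natDegree_mul hG.ne_zero hT0] at hd2
      omega
  · rintro l ⟨f, hfl, hf0, hf⟩
    have hfne : f ≠ 0 := by
      rintro rfl
      simp at hf0
    refine le_trans (natDegree_le_of_dvd (genPoly_dvd_of_dvd_mul hn ?_) hfne) hfl
    -- The recurrence kills every coefficient from `l` on, so truncation loses nothing and the
    -- product is a polynomial.
    set R : F[X] := PowerSeries.trunc l ((f : PowerSeries F) * PowerSeries.mk s)
    have hR : (f : PowerSeries F) * PowerSeries.mk s = (R : PowerSeries F) := by
      ext j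
      rw [Polynomial.coeff_coe, PowerSeries.coeff_trunc]
      split_ifs with h
      · rfl
      · rw [coeff_mul_mk hfl s (by omega), hf j (by omega)]
    have h4 : ((f * S : F[X]) : PowerSeries F) = ((R * (1 - X ^ n) : F[X]) : PowerSeries F) := by
      rw [Polynomial.coe_mul, ← hmk, ← mul_assoc, hR]
      simp
    rw [Polynomial.coe_injective F h4]
    exact ⟨-R, by ring⟩

end LinearSpan

/-! ### Root sets of divisors of `x^N - 1` and descent to the base field -/

theorem FiniteField.mem_range_algebraMap_of_pow_card_eq {F K : Type*} [Field F] [Fintype F]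
    [Field K] [Algebra F K] {c : K} (hc : c ^ Fintype.card F = c) :
    c ∈ Set.range (algebraMap F K) := by
  have hm : (X ^ Fintype.card F - X : F[X]).Monic := monic_X_pow_sub (by
    rw [degree_X]
    exact_mod_cast Fintype.one_lt_card)
  have h := prod_multiset_X_sub_C_of_monic_of_roots_card_eq hm (by
    rw [FiniteField.roots_X_pow_card_sub_X,
      FiniteField.X_pow_card_sub_X_natDegree_eq F Fintype.one_lt_card]
    rfl)
  rw [FiniteField.roots_X_pow_card_sub_X] at h
  -- Over `F`, `X^q - X` is the product of all `X - a`; its vanishing at `c` makes `c` one of the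
  -- `a`.
  have h1 := congrArg (aeval c) h
  rw [map_sub, map_pow, aeval_X, hc, sub_self] at h1
  change aeval c (∏ a : F, (X - C a)) = 0 at h1
  rw [map_prod, Finset.prod_eq_zero_iff] at h1
  obtain ⟨a, -, ha⟩ := h1
  rw [map_sub, aeval_X, aeval_C, sub_eq_zero] at ha
  exact ⟨a, ha.symm⟩

section Roots

variable {K : Type*} [Field K] {N : ℕ} {β : K}

namespace IsPrimitiveRoot

theorem pow_val_natCast (hβ : IsPrimitiveRoot β N) (k : ℕ) :
    β ^ (k : ZMod N).val = β ^ k := by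
  rw [ZMod.val_natCast, hβ.eq_orderOf, pow_mod_orderOf]

theorem pow_val_add [NeZero N] (hβ : IsPrimitiveRoot β N) (x y : ZMod N) :
    β ^ (x + y).val = β ^ x.val * β ^ y.val := by
  rw [← pow_add, ← hβ.pow_val_natCast (_ + _), Nat.cast_add, ZMod.natCast_zmod_val, ZMod.natCast_zmod_val]

theorem pow_val_mul [NeZero N] (hβ : IsPrimitiveRoot β N) (x y : ZMod N) :
    β ^ (x * y).val = (β ^ x.val) ^ y.val := by
  rw [← pow_mul, ← hβ.pow_val_natCast (_ * _), Nat.cast_mul, ZMod.natCast_zmod_val, ZMod.natCast_zmod_val]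

theorem pow_val_eq_one_iff [NeZero N] (hβ : IsPrimitiveRoot β N) (x : ZMod N) :
    β ^ x.val = 1 ↔ x = 0 := by
  rw [hβ.pow_eq_one_iff_dvd, ← ZMod.natCast_eq_zero_iff, ZMod.natCast_zmod_val]

theorem pow_val_injective [NeZero N] (hβ : IsPrimitiveRoot β N) :
    Function.Injective fun x : ZMod N => β ^ x.val := fun x y h =>
  ZMod.val_injective N (hβ.pow_inj (ZMod.val_lt x) (ZMod.val_lt y) h)

end IsPrimitiveRoot

open Whiteman

theorem rootPoly_monic (S : Finset (ZMod N)) : (rootPoly β S).Monic :=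
  monic_prod_of_monic _ _ fun _ _ => monic_X_sub_C _

theorem natDegree_rootPoly (S : Finset (ZMod N)) : (rootPoly β S).natDegree = S.card := by
  rw [rootPoly, natDegree_prod_of_monic _ _ fun _ _ => monic_X_sub_C _]
  simp only [natDegree_X_sub_C, Finset.sum_const, smul_eq_mul, mul_one]

/-- As `x^N - 1` splits with simple roots, a monic divisor is determined by its zero set. -/
theorem eq_rootPoly_of_dvd [NeZero N] (hβ : IsPrimitiveRoot β N) {f : K[X]} (hf : f.Monic)
    (hd : f ∣ X ^ N - 1) {S : Finset (ZMod N)} (hS : ∀ x, x ∈ S ↔ f.eval (β ^ x.val) = 0) :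
    f = rootPoly β S := by
  classical
  have hsplit : (X ^ N - 1 : K[X]).Splits := X_pow_sub_one_splits hβ
  have hfs : f.Splits := hsplit.of_dvd (X_pow_sub_one_ne_zero (NeZero.ne N)) hd
  have hsep : (X ^ N - 1 : K[X]).Separable := by
    -- A primitive `N`-th root of unity can exist only if `N ≠ 0` in `K`, which gives separability.
    have := hβ.neZero'
    exact separable_X_pow_sub_C (1 : K) (NeZero.ne _) one_ne_zero
  have hnd : f.roots.Nodup := nodup_roots (hsep.of_dvd hd)
  have hroots : f.roots = S.val.map fun x : ZMod N => β ^ x.val := by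
    rw [Multiset.Nodup.ext hnd (S.nodup.map hβ.pow_val_injective)]
    intro a
    rw [mem_roots hf.ne_zero, IsRoot.def, Multiset.mem_map]
    constructor
    · intro ha
      have h1 : (X ^ N - 1 : K[X]).eval a = 0 := by
        obtain ⟨r, hr⟩ := hd
        rw [hr, eval_mul, ha, zero_mul]
      rw [eval_sub, eval_pow, eval_X, eval_one, sub_eq_zero] at h1
      obtain ⟨i, hi, rfl⟩ := hβ.eq_pow_of_pow_eq_one h1
      refine ⟨(i : ZMod N), ?_, hβ.pow_val_natCast i⟩
      rw [Finset.mem_val, hS, hβ.pow_val_natCast, ha]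
    · rintro ⟨x, hx, rfl⟩
      exact (hS x).1 hx
  rw [hfs.eq_prod_roots_of_monic hf, hroots, Multiset.map_map]
  rfl

theorem map_monicGcd_eq_rootPoly [NeZero N] {F : Type*} [Field F] [Algebra F K]
    (hβ : IsPrimitiveRoot β N) (T : F[X]) {S : Finset (ZMod N)}
    (hS : ∀ x, x ∈ S ↔ aeval (β ^ x.val) T = 0) :
    (monicGcd (X ^ N - 1) T).map (algebraMap F K) = rootPoly β S := by
  have h0 := X_pow_sub_one_ne_zero (F := F) (NeZero.ne N)
  refine eq_rootPoly_of_dvd hβ ((monicGcd_monic h0 T).map _) ?_ fun x => ?_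
  · have := Polynomial.map_dvd (algebraMap F K) (monicGcd_dvd_left (X ^ N - 1) T)
    simpa using this
  · rw [hS, eval_map_algebraMap]
    constructor
    · intro h
      obtain ⟨r, s, hrs⟩ := exists_monicGcd_eq (X ^ N - 1) T
      have hx : (β ^ x.val) ^ N = 1 := by rw [← pow_mul, mul_comm, pow_mul, hβ.pow_eq_one, one_pow]
      rw [hrs, map_add, map_mul, map_mul, h, map_sub, map_pow, aeval_X, map_one, hx, sub_self,
        zero_mul, zero_mul, add_zero]
    · intro h
      obtain ⟨r, hr⟩ := monicGcd_dvd_right (X ^ N - 1) T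
      rw [hr, map_mul, h, zero_mul]

theorem map_genPoly_mul_rootPoly [NeZero N] {F : Type*} [Field F] [Algebra F K]
    (hβ : IsPrimitiveRoot β N) (T : F[X]) {S : Finset (ZMod N)}
    (hS : ∀ x, x ∈ S ↔ aeval (β ^ x.val) T = 0) :
    (genPoly N T).map (algebraMap F K) * rootPoly β S = X ^ N - 1 := by
  rw [← map_monicGcd_eq_rootPoly hβ T hS, ← Polynomial.map_mul, genPoly_mul_monicGcd]
  simp

/-- The subgroup of multiples of `a` in `ℤ/N`, where `N = ab`, gives the `b`-th roots of unity. -/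
theorem X_pow_sub_one_eq_rootPoly [NeZero N] (hβ : IsPrimitiveRoot β N) {a b : ℕ} (hN : N = a * b)
    {S : Finset (ZMod N)} (hS : ∀ x, x ∈ S ↔ (b : ZMod N) * x = 0) :
    X ^ b - 1 = rootPoly β S := by
  have hb : b ≠ 0 := by
    rintro rfl
    exact NeZero.ne N (by rw [hN, mul_zero])
  rw [← C_1]
  refine eq_rootPoly_of_dvd hβ (monic_X_pow_sub_C (1 : K) hb) ?_ fun x => ?_
  · rw [hN, mul_comm, pow_mul]
    simpa using sub_dvd_pow_sub_pow (X ^ b : K[X]) 1 a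
  · rw [hS, eval_sub, eval_pow, eval_X, eval_C, sub_eq_zero, ← pow_mul, ← hβ.pow_val_natCast,
      hβ.pow_val_eq_one_iff, Nat.cast_mul, ZMod.natCast_zmod_val, mul_comm]

/-- Frobenius sends `β^x` to `β^{qx}`, so it permutes the roots and fixes the coefficients, which
therefore lie in `F`. -/
theorem rootPoly_lifts [NeZero N] {F : Type*} [Field F] [Fintype F] [Algebra F K]
    (hβ : IsPrimitiveRoot β N) {S : Finset (ZMod N)}
    (hS : ∀ x ∈ S, (Fintype.card F : ZMod N) * x ∈ S)
    (hu : IsUnit (Fintype.card F : ZMod N)) :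
    rootPoly β S ∈ lifts (algebraMap F K) := by
  classical
  set q := Fintype.card F
  have hmap : (rootPoly β S).map (FiniteField.frobeniusAlgHom F K : K →+* K) = rootPoly β S := by
    have himg : S.image (fun x => (q : ZMod N) * x) = S := by
      refine Finset.eq_of_subset_of_card_le (Finset.image_subset_iff.2 hS) ?_
      rw [Finset.card_image_of_injective _ hu.mul_right_injective]
    conv_rhs => rw [← himg]
    rw [rootPoly, rootPoly, Polynomial.map_prod,
      Finset.prod_image fun x _ y _ h => hu.mul_right_injective h]
    refine Finset.prod_congr rfl fun x _ => ?_
    rw [Polynomial.map_sub, map_X, map_C, hβ.pow_val_mul, hβ.pow_val_natCast, ← pow_mul, mul_comm q, pow_mul]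
    rfl
  rw [lifts_iff_coeff_lifts]
  intro k
  have hk := congrArg (fun f => coeff f k) hmap
  simp only [coeff_map] at hk
  have hq : (rootPoly β S).coeff k ^ q = (rootPoly β S).coeff k := hk
  exact FiniteField.mem_range_algebraMap_of_pow_card_eq hq

/-- A relation between powers of a primitive `N`-th root of unity in characteristic zero holds
in every field. -/
theorem aeval_eq_zero_of_complex [NeZero N] (hβ : IsPrimitiveRoot β N) {ζ : ℂ}
    (hζ : IsPrimitiveRoot ζ N) {T : ℤ[X]} (hT : aeval ζ T = 0) : aeval β T = 0 := by
  -- The minimal polynomial of `ζ` over `ℤ` is the cyclotomic polynomial, which also vanishes at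
  -- `β`.
  have h := minpoly.isIntegrallyClosed_dvd (hζ.isIntegral (NeZero.pos N)) hT
  rw [← cyclotomic_eq_minpoly hζ (NeZero.pos N)] at h
  obtain ⟨r, rfl⟩ := h
  have h2 : aeval β (cyclotomic N ℤ) = 0 := by
    rw [aeval_def, eval₂_eq_eval_map, map_cyclotomic]
    exact hβ.isRoot_cyclotomic (NeZero.pos N)
  rw [map_mul, h2, zero_mul]

end Roots

/-! ### Primitive roots modulo a prime -/

theorem exists_pow_eq_of_isPrimitiveRootMod {p : ℕ} [Fact p.Prime] {g : ℤ}
    (hg : IsPrimitiveRootMod g p) {x : ZMod p} (hx : x ≠ 0) : ∃ a : ℕ, (g : ZMod p) ^ a = x := by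
  have h := IsPrimitiveRoot.orderOf (g : ZMod p)
  rw [hg.2, Nat.totient_prime Fact.out] at h
  have : NeZero (p - 1) := ⟨by have := (Fact.out : p.Prime).two_le; omega⟩
  obtain ⟨a, -, ha⟩ := h.eq_pow_of_pow_eq_one (ZMod.pow_card_sub_one_eq_one hx)
  exact ⟨a, ha⟩

theorem IsPrimitiveRootMod.pow_eq_pow {p : ℕ} [Fact p.Prime] {g : ℤ}
    (hg : IsPrimitiveRootMod g p) {a b : ℕ} (h : a ≡ b [MOD p - 1]) :
    (g : ZMod p) ^ a = (g : ZMod p) ^ b := by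
  rw [← pow_mod_orderOf, ← pow_mod_orderOf _ b, hg.2, Nat.totient_prime Fact.out, h]

theorem IsPrimitiveRootMod.ne_zero {p : ℕ} [Fact p.Prime] {g : ℤ}
    (hg : IsPrimitiveRootMod g p) : (g : ZMod p) ≠ 0 := by
  intro h
  have h1 := hg.pow_eq_pow (a := p - 1) (b := 0) (by simp [Nat.ModEq])
  rw [h, pow_zero, zero_pow (by have := (Fact.out : p.Prime).two_le; omega)] at h1
  exact zero_ne_one h1

/-- If `g` were a square, then `g^{(p-1)/2} = 1`, against its order being `p - 1`. -/
theorem IsPrimitiveRootMod.quadraticChar_eq {p : ℕ} [Fact p.Prime] {g : ℤ}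
    (hg : IsPrimitiveRootMod g p) (hp : Odd p) : quadraticChar (ZMod p) g = -1 := by
  rw [quadraticChar_neg_one_iff_not_isSquare]
  rintro ⟨y, hy⟩
  have hp2 := (Fact.out : p.Prime).two_le
  obtain ⟨k, rfl⟩ := hp
  have hy0 : y ≠ 0 := by
    rintro rfl
    exact hg.ne_zero (by simpa using hy)
  have h1 : (g : ZMod (2 * k + 1)) ^ k = 1 := by
    rw [hy, ← pow_two, ← pow_mul]
    simpa using ZMod.pow_card_sub_one_eq_one hy0
  have h2 := orderOf_dvd_of_pow_eq_one h1
  rw [hg.2, Nat.totient_prime Fact.out] at h2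
  have := Nat.le_of_dvd (by omega) h2
  omega

/-! ### The generalized cyclotomic classes as fibres of the Jacobi symbol -/

namespace Whiteman

/-- The reduction `ℤ/n₁n₂ → ℤ/n₁`. -/
def red₁ (n₁ n₂ : ℕ) : ZMod (n₁ * n₂) →+* ZMod n₁ := ZMod.castHom (dvd_mul_right n₁ n₂) (ZMod n₁)

/-- The reduction `ℤ/n₁n₂ → ℤ/n₂`. -/
def red₂ (n₁ n₂ : ℕ) : ZMod (n₁ * n₂) →+* ZMod n₂ := ZMod.castHom (dvd_mul_left n₂ n₁) (ZMod n₂)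

/-- The Jacobi symbol modulo `n₁n₂`, the product of the quadratic characters modulo `n₁`
and `n₂`. -/
def symbol (n₁ n₂ : ℕ) [Fact n₁.Prime] [Fact n₂.Prime] : ZMod (n₁ * n₂) →* ℤ :=
  ((quadraticChar (ZMod n₁)).toMonoidHom.comp (red₁ n₁ n₂ : ZMod (n₁ * n₂) →* ZMod n₁)) *
    ((quadraticChar (ZMod n₂)).toMonoidHom.comp (red₂ n₁ n₂ : ZMod (n₁ * n₂) →* ZMod n₂))

/-- The standing hypotheses on the moduli `n₁, n₂` and on the integers `g, u`. -/
structure IsSetup (n₁ n₂ : ℕ) (g u : ℤ) : Prop where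
  odd₁ : Odd n₁
  odd₂ : Odd n₂
  ne : n₁ ≠ n₂
  order_eq : order n₁ n₂ = 6
  prim₁ : IsPrimitiveRootMod g n₁
  prim₂ : IsPrimitiveRootMod g n₂
  u_mod₁ : u ≡ g [ZMOD n₁]
  u_mod₂ : u ≡ 1 [ZMOD n₂]

section

variable {n₁ n₂ : ℕ} [Fact n₁.Prime] [Fact n₂.Prime] {g u : ℤ}

theorem symbol_apply (x : ZMod (n₁ * n₂)) : symbol n₁ n₂ x =
    quadraticChar (ZMod n₁) (red₁ n₁ n₂ x) * quadraticChar (ZMod n₂) (red₂ n₁ n₂ x) := rfl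

theorem symbol_eq_zero_iff (x : ZMod (n₁ * n₂)) :
    symbol n₁ n₂ x = 0 ↔ red₁ n₁ n₂ x = 0 ∨ red₂ n₁ n₂ x = 0 := by
  rw [symbol_apply, mul_eq_zero, quadraticChar_eq_zero_iff, quadraticChar_eq_zero_iff]

theorem symbol_trichotomy (x : ZMod (n₁ * n₂)) :
    symbol n₁ n₂ x = 0 ∨ symbol n₁ n₂ x = 1 ∨ symbol n₁ n₂ x = -1 := by
  by_cases h : symbol n₁ n₂ x = 0
  · exact Or.inl h
  · right
    rw [symbol_eq_zero_iff, not_or] at h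
    rw [symbol_apply]
    rcases quadraticChar_dichotomy h.1 with h1 | h1 <;>
    rcases quadraticChar_dichotomy h.2 with h2 | h2 <;> simp [h1, h2]

namespace IsSetup

variable (hs : IsSetup n₁ n₂ g u)
include hs

theorem coprime : n₁.Coprime n₂ :=
  (Nat.coprime_primes Fact.out Fact.out).2 hs.ne

theorem red_ext {x y : ZMod (n₁ * n₂)} (h₁ : red₁ n₁ n₂ x = red₁ n₁ n₂ y)
    (h₂ : red₂ n₁ n₂ x = red₂ n₁ n₂ y) : x = y := by
  rw [← sub_eq_zero] at h₁ h₂ ⊢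
  rw [← map_sub] at h₁ h₂
  have hN : NeZero (n₁ * n₂) := ⟨mul_ne_zero (NeZero.ne _) (NeZero.ne _)⟩
  rw [← ZMod.natCast_zmod_val (x - y)] at h₁ h₂ ⊢
  rw [map_natCast, ZMod.natCast_eq_zero_iff] at h₁ h₂
  rw [ZMod.natCast_eq_zero_iff]
  exact hs.coprime.mul_dvd_of_dvd_of_dvd h₁ h₂

theorem eq_zero_iff (x : ZMod (n₁ * n₂)) : x = 0 ↔ red₁ n₁ n₂ x = 0 ∧ red₂ n₁ n₂ x = 0 := by
  constructor
  · rintro rfl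
    simp
  · rintro ⟨h1, h2⟩
    exact hs.red_ext (by simpa using h1) (by simpa using h2)

omit [Fact n₂.Prime] in
theorem red₁_u : red₁ n₁ n₂ (u : ZMod (n₁ * n₂)) = (g : ZMod n₁) := by
  rw [map_intCast]
  exact (ZMod.intCast_eq_intCast_iff _ _ _).2 hs.u_mod₁

omit [Fact n₁.Prime] in
theorem red₂_u : red₂ n₁ n₂ (u : ZMod (n₁ * n₂)) = 1 := by
  rw [map_intCast, ← Int.cast_one]
  exact (ZMod.intCast_eq_intCast_iff _ _ _).2 hs.u_mod₂

theorem symbol_g : symbol n₁ n₂ (g : ZMod (n₁ * n₂)) = 1 := by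
  rw [symbol_apply, map_intCast (red₁ n₁ n₂), map_intCast (red₂ n₁ n₂), hs.prim₁.quadraticChar_eq hs.odd₁,
    hs.prim₂.quadraticChar_eq hs.odd₂]
  rfl

theorem symbol_u : symbol n₁ n₂ (u : ZMod (n₁ * n₂)) = -1 := by
  rw [symbol_apply, hs.red₁_u, hs.red₂_u, hs.prim₁.quadraticChar_eq hs.odd₁]
  simp

theorem symbol_of_mem_W {i : ℕ} {x : ZMod (n₁ * n₂)} (hx : x ∈ W n₁ n₂ g u i) :
    symbol n₁ n₂ x = (-1) ^ i := by
  obtain ⟨s, -, rfl⟩ := Finset.mem_image.1 hx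
  rw [map_mul, map_pow, map_pow, hs.symbol_g, hs.symbol_u, one_pow, one_mul]

/-- With `x = g^a` modulo `n₁` and `x = g^b` modulo `n₂`, the equation `x = g^s u^i` means `s + i ≡
a` modulo `n₁ - 1` and `s ≡ b` modulo `n₂ - 1`. It is solvable in `s` exactly when `i ≡ a - b`
modulo the gcd `6`. -/
theorem exists_mem_W {x : ZMod (n₁ * n₂)} (hx : symbol n₁ n₂ x ≠ 0) :
    ∃ i < 6, x ∈ W n₁ n₂ g u i := by
  rw [Ne, symbol_eq_zero_iff, not_or] at hx
  obtain ⟨a, ha⟩ := exists_pow_eq_of_isPrimitiveRootMod hs.prim₁ hx.1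
  obtain ⟨b, hb⟩ := exists_pow_eq_of_isPrimitiveRootMod hs.prim₂ hx.2
  have h2₁ := (Fact.out : n₁.Prime).two_le
  have h2₂ := (Fact.out : n₂.Prime).two_le
  have ho := hs.order_eq
  rw [order] at ho
  obtain ⟨m, hm⟩ : 6 ∣ n₁ - 1 := ho ▸ Nat.gcd_dvd_left _ _
  -- This is `a - b` modulo `6`, without subtraction in `ℕ`; likewise `(n₁ - 2) * i` below stands
  -- for `-i` modulo `n₁ - 1`.
  set i := (a + 5 * b) % 6 with hi
  have hmod : a + (n₁ - 2) * i ≡ b [MOD Nat.gcd (n₁ - 1) (n₂ - 1)] := by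
    rw [ho]
    obtain ⟨k, hk⟩ : ∃ k, n₁ - 2 = 6 * k + 5 := ⟨m - 1, by omega⟩
    rw [hk, add_mul, mul_assoc, Nat.ModEq]
    generalize k * i = t
    omega
  let c := Nat.chineseRemainder' hmod
  -- The lcm of `n₁ - 1` and `n₂ - 1` is exactly `e`, so the solution lies in the range of exponents
  -- defining `W`.
  have hlt := Nat.chineseRemainder'_lt_lcm hmod (by omega) (by omega)
  refine ⟨i, Nat.mod_lt _ (by norm_num), Finset.mem_image.2 ⟨c, ?_, ?_⟩⟩
  · rw [Finset.mem_range]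
    exact hlt
  · refine hs.red_ext ?_ ?_
    · rw [map_mul, map_pow, map_pow, map_intCast, hs.red₁_u, ← pow_add, ← ha]
      refine hs.prim₁.pow_eq_pow ((c.2.1.add_right i).trans ?_)
      have : a + (n₁ - 2) * i + i = a + (n₁ - 1) * i := by
        obtain ⟨r, hr⟩ := Nat.exists_eq_add_of_le h2₁
        subst hr
        have h1 : 2 + r - 1 = r + 1 := by omega
        rw [Nat.add_sub_cancel_left, h1]
        ring
      rw [this]
      simp [Nat.ModEq]
    · rw [map_mul, map_pow, map_pow, map_intCast, hs.red₂_u, one_pow, mul_one, ← hb]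
      exact hs.prim₂.pow_eq_pow c.2.2

/-- The symbol is `1` at `g` and `-1` at `u`, hence `(-1)^i` on `W_i`; the six classes cover all
residues of nonzero symbol, so the parity of `i` decides. -/
theorem mem_D₀ (x : ZMod (n₁ * n₂)) : x ∈ D₀ n₁ n₂ g u ↔ symbol n₁ n₂ x = 1 := by
  rw [D₀, hs.order_eq, Finset.mem_biUnion]
  constructor
  · rintro ⟨i, -, hi⟩
    rw [hs.symbol_of_mem_W hi, pow_mul]
    simp
  · intro h
    obtain ⟨i, hi, hx⟩ := hs.exists_mem_W (x := x) (by rw [h]; norm_num)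
    rw [hs.symbol_of_mem_W hx] at h
    obtain ⟨j, rfl⟩ : Even i := by
      by_contra hodd
      rw [(Nat.not_even_iff_odd.1 hodd).neg_one_pow] at h
      norm_num at h
    exact ⟨j, Finset.mem_range.2 (by omega), by rwa [two_mul]⟩

theorem mem_D₁ (x : ZMod (n₁ * n₂)) : x ∈ D₁ n₁ n₂ g u ↔ symbol n₁ n₂ x = -1 := by
  rw [D₁, hs.order_eq, Finset.mem_biUnion]
  constructor
  · rintro ⟨i, -, hi⟩
    rw [hs.symbol_of_mem_W hi, pow_succ, pow_mul]
    simp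
  · intro h
    obtain ⟨i, hi, hx⟩ := hs.exists_mem_W (x := x) (by rw [h]; norm_num)
    rw [hs.symbol_of_mem_W hx] at h
    obtain ⟨j, rfl⟩ : Odd i := by
      by_contra hev
      rw [(Nat.not_odd_iff_even.1 hev).neg_one_pow] at h
      norm_num at h
    exact ⟨j, Finset.mem_range.2 (by omega), hx⟩

theorem mem_P (x : ZMod (n₁ * n₂)) :
    x ∈ P n₁ n₂ ↔ red₁ n₁ n₂ x = 0 ∧ red₂ n₁ n₂ x ≠ 0 := by
  have h1 := (Fact.out : n₁.Prime).pos
  have h2 := (Fact.out : n₂.Prime).pos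
  have hN : NeZero (n₁ * n₂) := ⟨(Nat.mul_pos h1 h2).ne'⟩
  rw [P, Finset.mem_image]
  constructor
  · rintro ⟨k, hk, rfl⟩
    rw [Finset.mem_Icc] at hk
    rw [map_natCast, map_natCast, Ne, ZMod.natCast_eq_zero_iff, ZMod.natCast_eq_zero_iff]
    refine ⟨dvd_mul_left _ _, fun h => ?_⟩
    have := Nat.le_of_dvd (by omega) (hs.coprime.symm.dvd_of_dvd_mul_right h)
    omega
  · rw [← ZMod.natCast_zmod_val x, map_natCast, map_natCast, Ne, ZMod.natCast_eq_zero_iff,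
      ZMod.natCast_eq_zero_iff]
    rintro ⟨⟨k, hk⟩, hx⟩
    have hlt := ZMod.val_lt x
    rw [hk] at hlt hx
    refine ⟨k, Finset.mem_Icc.2 ⟨?_, ?_⟩, by rw [hk, mul_comm k]⟩
    · rcases Nat.eq_zero_or_pos k with rfl | h
      · simp at hx
      · exact h
    · have := lt_of_mul_lt_mul_left hlt h1.le
      omega

theorem mul_red₁ (x : ZMod (n₁ * n₂)) : (n₂ : ZMod (n₁ * n₂)) * x = 0 ↔ red₁ n₁ n₂ x = 0 := by
  rw [hs.eq_zero_iff, map_mul, map_mul, map_natCast, map_natCast, ZMod.natCast_self, zero_mul,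
    mul_eq_zero, ZMod.natCast_eq_zero_iff]
  have : ¬ n₁ ∣ n₂ := fun h => hs.ne ((Nat.prime_dvd_prime_iff_eq Fact.out Fact.out).1 h)
  simp [this]

theorem mul_red₂ (x : ZMod (n₁ * n₂)) : (n₁ : ZMod (n₁ * n₂)) * x = 0 ↔ red₂ n₁ n₂ x = 0 := by
  rw [hs.eq_zero_iff, map_mul, map_mul, map_natCast, map_natCast, ZMod.natCast_self, zero_mul,
    mul_eq_zero, ZMod.natCast_eq_zero_iff]
  have : ¬ n₂ ∣ n₁ := fun h => hs.ne ((Nat.prime_dvd_prime_iff_eq Fact.out Fact.out).1 h).symm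
  simp [this]

theorem isUnit_of_symbol_ne_zero {x : ZMod (n₁ * n₂)} (hx : symbol n₁ n₂ x ≠ 0) : IsUnit x := by
  rw [Ne, symbol_eq_zero_iff, not_or] at hx
  have hN : NeZero (n₁ * n₂) := ⟨mul_ne_zero (NeZero.ne _) (NeZero.ne _)⟩
  have hinj : Function.Injective fun y => x * y := fun y z hyz => by
    refine hs.red_ext (mul_left_cancel₀ hx.1 ?_) (mul_left_cancel₀ hx.2 ?_)
    · rw [← map_mul, ← map_mul]
      exact congrArg _ hyz
    · rw [← map_mul, ← map_mul]
      exact congrArg _ hyz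
  obtain ⟨y, hy⟩ := Finite.injective_iff_surjective.1 hinj 1
  exact IsUnit.of_mul_eq_one y hy

end IsSetup

end

end Whiteman

/-! ### Exponential sums and the quadratic Gauss sum -/

namespace Whiteman

/-- The exponential sum `∑_{x ∈ S} β^{kx}`. -/
def expSum {K : Type*} [Field K] {N : ℕ} (β : K) (S : Finset (ZMod N)) (k : ZMod N) : K :=
  ∑ x ∈ S, β ^ (k * x).val

/-- The integral polynomial whose value at `β` is the exponential sum `∑_{x ∈ S} β^{kx}`. -/
noncomputable def expPoly {N : ℕ} (S : Finset (ZMod N)) (k : ZMod N) : ℤ[X] :=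
  ∑ x ∈ S, X ^ (k * x).val

section

variable {K : Type*} [Field K] {N : ℕ} {β : K}

theorem aeval_expPoly (S : Finset (ZMod N)) (k : ZMod N) :
    aeval β (expPoly S k) = expSum β S k := by
  simp [expPoly, expSum]

/-- Translating by `t` permutes `S` but multiplies the sum by `β^{kt} ≠ 1`. -/
theorem expSum_eq_zero_of_shift [NeZero N] (hβ : IsPrimitiveRoot β N) {S : Finset (ZMod N)}
    {k t : ZMod N} (hS : ∀ x, x ∈ S ↔ x + t ∈ S) (hkt : k * t ≠ 0) : expSum β S k = 0 := by
  have h : expSum β S k = β ^ (k * t).val * expSum β S k := by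
    conv_lhs => rw [expSum]
    rw [expSum, Finset.mul_sum, eq_comm]
    refine Finset.sum_equiv (Equiv.addRight t) hS fun x _ => ?_
    rw [Equiv.coe_addRight, mul_add, hβ.pow_val_add, mul_comm]
  have h1 : (β ^ (k * t).val - 1) * expSum β S k = 0 := by linear_combination -h
  exact (mul_eq_zero.1 h1).resolve_left
    (sub_ne_zero.2 fun h2 => hkt ((hβ.pow_val_eq_one_iff _).1 h2))

theorem expSum_eq_card {S : Finset (ZMod N)} {k : ZMod N} (hS : ∀ x ∈ S, k * x = 0) :
    expSum β S k = S.card := by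
  rw [expSum, Finset.sum_congr rfl fun x hx => by rw [hS x hx, ZMod.val_zero, pow_zero]]
  simp

theorem expSum_univ_of_ne_zero [NeZero N] (hβ : IsPrimitiveRoot β N) {k : ZMod N} (hk : k ≠ 0) :
    expSum β Finset.univ k = 0 :=
  expSum_eq_zero_of_shift hβ (t := 1) (by simp) (by rwa [mul_one])

theorem expSum_univ_zero [NeZero N] : expSum β (Finset.univ : Finset (ZMod N)) 0 = N := by
  rw [expSum_eq_card (by simp), Finset.card_univ, ZMod.card]

theorem expSum_mul_unit [NeZero N] {S T : Finset (ZMod N)} {k c : ZMod N} (hc : IsUnit c)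
    (hST : ∀ x, x ∈ S ↔ c * x ∈ T) : expSum β S (k * c) = expSum β T k := by
  refine Finset.sum_equiv (Units.mulLeft hc.unit) ?_ fun x _ => ?_
  · intro x
    simp [hST]
  · rw [Units.mulLeft_apply, IsUnit.unit_spec, mul_assoc]

end

section

variable {n₁ n₂ : ℕ} [Fact n₁.Prime] [Fact n₂.Prime] {g u : ℤ}

/-- The residues that vanish modulo `n₁`. -/
def ker₁ (n₁ n₂ : ℕ) [NeZero (n₁ * n₂)] : Finset (ZMod (n₁ * n₂)) :=
  Finset.univ.filter fun x => red₁ n₁ n₂ x = 0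

/-- The residues that vanish modulo `n₂`. -/
def ker₂ (n₁ n₂ : ℕ) [NeZero (n₁ * n₂)] : Finset (ZMod (n₁ * n₂)) :=
  Finset.univ.filter fun x => red₂ n₁ n₂ x = 0

/-- The quadratic Gauss sum `∑ₓ (x / n₁n₂) β^{kx}`. -/
noncomputable def gauss {K : Type*} [Field K] [NeZero (n₁ * n₂)] (β : K) (k : ZMod (n₁ * n₂)) : K :=
  ∑ x, (symbol n₁ n₂ x : K) * β ^ (k * x).val

omit [Fact n₂.Prime] in
theorem mem_ker₁ [NeZero (n₁ * n₂)] (x : ZMod (n₁ * n₂)) :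
    x ∈ ker₁ n₁ n₂ ↔ red₁ n₁ n₂ x = 0 := by simp [ker₁]

omit [Fact n₁.Prime] in
theorem mem_ker₂ [NeZero (n₁ * n₂)] (x : ZMod (n₁ * n₂)) :
    x ∈ ker₂ n₁ n₂ ↔ red₂ n₁ n₂ x = 0 := by simp [ker₂]

namespace IsSetup

variable (hs : IsSetup n₁ n₂ g u) [NeZero (n₁ * n₂)]
include hs

variable {K : Type*} [Field K] {β : K}

theorem rootPoly_ker₁ (hβ : IsPrimitiveRoot β (n₁ * n₂)) :
    rootPoly β (ker₁ n₁ n₂) = X ^ n₂ - 1 :=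
  (X_pow_sub_one_eq_rootPoly hβ rfl fun x => by rw [mem_ker₁, hs.mul_red₁]).symm

theorem rootPoly_ker₂ (hβ : IsPrimitiveRoot β (n₁ * n₂)) :
    rootPoly β (ker₂ n₁ n₂) = X ^ n₁ - 1 :=
  (X_pow_sub_one_eq_rootPoly hβ (mul_comm n₁ n₂) fun x => by rw [mem_ker₂, hs.mul_red₂]).symm

theorem card_ker₁ : (ker₁ n₁ n₂).card = n₂ := by
  rw [← natDegree_rootPoly (β := Complex.exp (2 * Real.pi * Complex.I / ((n₁ * n₂ : ℕ) : ℂ))),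
    hs.rootPoly_ker₁ (Complex.isPrimitiveRoot_exp _ (NeZero.ne _)), ← C_1, natDegree_X_pow_sub_C]

theorem card_ker₂ : (ker₂ n₁ n₂).card = n₁ := by
  rw [← natDegree_rootPoly (β := Complex.exp (2 * Real.pi * Complex.I / ((n₁ * n₂ : ℕ) : ℂ))),
    hs.rootPoly_ker₂ (Complex.isPrimitiveRoot_exp _ (NeZero.ne _)), ← C_1, natDegree_X_pow_sub_C]

theorem expSum_ker₁_of_ne (hβ : IsPrimitiveRoot β (n₁ * n₂)) {k : ZMod (n₁ * n₂)}
    (hk : red₂ n₁ n₂ k ≠ 0) : expSum β (ker₁ n₁ n₂) k = 0 := by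
  refine expSum_eq_zero_of_shift hβ (t := (n₁ : ZMod (n₁ * n₂))) (fun x => ?_) ?_
  · rw [mem_ker₁, mem_ker₁, map_add, map_natCast, ZMod.natCast_self, add_zero]
  · rwa [mul_comm k, Ne, hs.mul_red₂]

theorem expSum_ker₂_of_ne (hβ : IsPrimitiveRoot β (n₁ * n₂)) {k : ZMod (n₁ * n₂)}
    (hk : red₁ n₁ n₂ k ≠ 0) : expSum β (ker₂ n₁ n₂) k = 0 := by
  refine expSum_eq_zero_of_shift hβ (t := (n₂ : ZMod (n₁ * n₂))) (fun x => ?_) ?_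
  · rw [mem_ker₂, mem_ker₂, map_add, map_natCast, ZMod.natCast_self, add_zero]
  · rwa [mul_comm k, Ne, hs.mul_red₁]

theorem expSum_ker₁_of_eq {k : ZMod (n₁ * n₂)} (hk : red₂ n₁ n₂ k = 0) :
    expSum β (ker₁ n₁ n₂) k = n₂ := by
  rw [expSum_eq_card fun x hx => ?_, hs.card_ker₁]
  rw [mem_ker₁] at hx
  rw [hs.eq_zero_iff, map_mul, map_mul, hx, hk, mul_zero, zero_mul]
  exact ⟨rfl, rfl⟩

theorem expSum_ker₂_of_eq {k : ZMod (n₁ * n₂)} (hk : red₁ n₁ n₂ k = 0) :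
    expSum β (ker₂ n₁ n₂) k = n₁ := by
  rw [expSum_eq_card fun x hx => ?_, hs.card_ker₂]
  rw [mem_ker₂] at hx
  rw [hs.eq_zero_iff, map_mul, map_mul, hx, hk, mul_zero, zero_mul]
  exact ⟨rfl, rfl⟩

theorem symbol_mul_gauss {c : ZMod (n₁ * n₂)} (hc : symbol n₁ n₂ c ≠ 0) (k : ZMod (n₁ * n₂)) :
    (symbol n₁ n₂ c : K) * gauss β (k * c) = gauss β k := by
  have hu := hs.isUnit_of_symbol_ne_zero hc
  rw [gauss, gauss, Finset.mul_sum]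
  conv_rhs => rw [← Equiv.sum_comp (Units.mulLeft hu.unit)]
  refine Finset.sum_congr rfl fun x _ => ?_
  rw [Units.mulLeft_apply, IsUnit.unit_spec, map_mul, Int.cast_mul, ← mul_assoc, ← mul_assoc]

/-- A unit `c` of symbol `-1` with `kc = k` changes the sign of the sum without changing the sum;
halving then needs characteristic zero. -/
theorem gauss_eq_zero [CharZero K] {k : ZMod (n₁ * n₂)} (hk : symbol n₁ n₂ k = 0) :
    gauss β k = 0 := by
  obtain ⟨c, hc, hkc⟩ : ∃ c, symbol n₁ n₂ c = -1 ∧ k * c = k := by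
    rcases (symbol_eq_zero_iff k).1 hk with h | h
    · refine ⟨u, hs.symbol_u, hs.red_ext ?_ ?_⟩
      · rw [map_mul, h, zero_mul]
      · rw [map_mul, hs.red₂_u, mul_one]
    -- This element is `g^{n₁ - 1} = 1` modulo `n₁` and the non-residue `g` modulo `n₂`.
    · refine ⟨g * u ^ (n₁ - 2), ?_, hs.red_ext ?_ ?_⟩
      · rw [map_mul, map_pow, hs.symbol_g, hs.symbol_u, one_mul]
        exact (Nat.Odd.sub_even (Fact.out : n₁.Prime).two_le hs.odd₁ even_two).neg_one_pow
      · rw [map_mul, map_mul, map_pow, hs.red₁_u, map_intCast (red₁ n₁ n₂), ← pow_succ']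
        have h1 : n₁ - 2 + 1 = n₁ - 1 := by
          have := (Fact.out : n₁.Prime).two_le
          omega
        rw [h1, ZMod.pow_card_sub_one_eq_one hs.prim₁.ne_zero, mul_one]
      · rw [map_mul, h, zero_mul]
  have h := hs.symbol_mul_gauss (β := β) (c := c) (by rw [hc]; norm_num) k
  rw [hkc, hc] at h
  push_cast at h
  have h2 : (2 : K) * gauss β k = 0 := by linear_combination -h
  simpa using h2

theorem gauss_eq_symbol_mul [CharZero K] (k : ZMod (n₁ * n₂)) :
    gauss β k = symbol n₁ n₂ k * gauss β (1 : ZMod (n₁ * n₂)) := by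
  by_cases hk : symbol n₁ n₂ k = 0
  · rw [hs.gauss_eq_zero hk, hk, Int.cast_zero, zero_mul]
  · have h := hs.symbol_mul_gauss (β := β) hk 1
    rw [one_mul] at h
    rw [← h]
    rcases symbol_trichotomy k with h1 | h1 | h1
    · exact absurd h1 hk
    · simp [h1]
    · simp [h1]

/-- Evaluate `∑_k G(k)β^{-k}` twice. Orthogonality leaves only the term `x = 1` and gives `n`; the
relation `G(k) = (k/n)G(1)` turns it into `G(1)G(-1)`. -/
theorem gauss_sq [CharZero K] (hβ : IsPrimitiveRoot β (n₁ * n₂)) :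
    symbol n₁ n₂ (-1) * gauss β (1 : ZMod (n₁ * n₂)) ^ 2 = ((n₁ * n₂ : ℕ) : K) := by
  have h1 : ∑ k : ZMod (n₁ * n₂), gauss β k * β ^ (k * -1).val = ((n₁ * n₂ : ℕ) : K) := by
    simp only [gauss, Finset.sum_mul]
    rw [Finset.sum_comm]
    have : ∀ x : ZMod (n₁ * n₂), ∑ k : ZMod (n₁ * n₂),
        (symbol n₁ n₂ x : K) * β ^ (k * x).val * β ^ (k * -1).val =
        if x = 1 then ((n₁ * n₂ : ℕ) : K) else 0 := by
      intro x
      have h2 : ∀ k : ZMod (n₁ * n₂),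
          (symbol n₁ n₂ x : K) * β ^ (k * x).val * β ^ (k * -1).val =
          symbol n₁ n₂ x * β ^ ((x - 1) * k).val := by
        intro k
        rw [mul_assoc, ← hβ.pow_val_add]
        congr 3
        ring
      rw [Finset.sum_congr rfl fun k _ => h2 k, ← Finset.mul_sum]
      change _ * expSum β Finset.univ (x - 1) = _
      split_ifs with hx
      · rw [hx, sub_self, expSum_univ_zero, map_one, Int.cast_one, one_mul]
      · rw [expSum_univ_of_ne_zero hβ (sub_ne_zero.2 hx), mul_zero]
    rw [Finset.sum_congr rfl fun x _ => this x]
    simp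
  rw [← h1]
  rw [Finset.sum_congr rfl fun k _ => by rw [hs.gauss_eq_symbol_mul k, mul_comm k (-1)]]
  have h3 := hs.gauss_eq_symbol_mul (β := β) (-1)
  calc _ = gauss β 1 * gauss β (-1) := by rw [h3]; ring
    _ = _ := by
      conv_lhs => rw [gauss.eq_1 β (-1), Finset.mul_sum]
      refine Finset.sum_congr rfl fun k _ => ?_
      ring

theorem symbol_neg_one : symbol n₁ n₂ (-1) = ZMod.χ₄ (n₁ * n₂ : ℕ) := by
  rw [symbol_apply, map_neg (red₁ n₁ n₂), map_neg (red₂ n₁ n₂), map_one, map_one, quadraticChar_neg_one,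
    quadraticChar_neg_one, ZMod.card, ZMod.card, Nat.cast_mul, map_mul]
  · rw [ZMod.ringChar_zmod_n]
    rintro rfl
    exact absurd hs.odd₂ (by decide)
  · rw [ZMod.ringChar_zmod_n]
    rintro rfl
    exact absurd hs.odd₁ (by decide)

/-- The sums over `D₀` and `D₁`, from the sum over the units (by inclusion and exclusion) and the
Gauss sum. -/
theorem expSum_D_aux (k : ZMod (n₁ * n₂)) :
    2 * expSum β (D₁ n₁ n₂ g u) k =
        (expSum β Finset.univ k - expSum β (ker₁ n₁ n₂) k - expSum β (ker₂ n₁ n₂) k + 1) -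
          gauss β k ∧
      2 * expSum β (D₀ n₁ n₂ g u) k =
        (expSum β Finset.univ k - expSum β (ker₁ n₁ n₂) k - expSum β (ker₂ n₁ n₂) k + 1) +
          gauss β k := by
  have hsum : ∀ S : Finset (ZMod (n₁ * n₂)), expSum β S k =
      ∑ x, (if x ∈ S then (1 : K) else 0) * β ^ (k * x).val := by
    intro S
    simp [expSum]
  have h1 : (1 : K) = ∑ x : ZMod (n₁ * n₂), (if x = 0 then (1 : K) else 0) * β ^ (k * x).val := by
    simp
  rw [h1]
  simp only [hsum, gauss, Finset.mul_sum, ← Finset.sum_sub_distrib, ← Finset.sum_add_distrib]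
  have key : ∀ x : ZMod (n₁ * n₂),
      (2 * (if x ∈ D₁ n₁ n₂ g u then (1 : K) else 0) = (1 - (if x ∈ ker₁ n₁ n₂ then 1 else 0) -
        (if x ∈ ker₂ n₁ n₂ then 1 else 0) + if x = 0 then 1 else 0) - symbol n₁ n₂ x) ∧
      (2 * (if x ∈ D₀ n₁ n₂ g u then (1 : K) else 0) = (1 - (if x ∈ ker₁ n₁ n₂ then 1 else 0) -
        (if x ∈ ker₂ n₁ n₂ then 1 else 0) + if x = 0 then 1 else 0) + symbol n₁ n₂ x) := by
    intro x
    simp only [hs.mem_D₁, hs.mem_D₀, mem_ker₁, mem_ker₂, hs.eq_zero_iff]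
    have h0 := symbol_eq_zero_iff x
    rcases symbol_trichotomy x with h | h | h
    · rw [h] at h0 ⊢
      rcases h0.1 rfl with h2 | h2 <;> by_cases h3 : red₁ n₁ n₂ x = 0 <;>
        by_cases h4 : red₂ n₁ n₂ x = 0 <;>
        first
        | exact absurd h2 ‹_›
        | (simp only [h3, h4]; norm_num)
    · rw [h] at h0 ⊢
      simp only [one_ne_zero, false_iff, not_or] at h0
      simp only [h0.1, h0.2]
      norm_num
    · rw [h] at h0 ⊢
      simp only [neg_eq_zero, one_ne_zero, false_iff, not_or] at h0
      simp only [h0.1, h0.2]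
      norm_num
  constructor <;> refine Finset.sum_congr rfl fun x _ => ?_
  · rw [if_pos (Finset.mem_univ x)]
    linear_combination β ^ (k * x).val * (key x).1
  · rw [if_pos (Finset.mem_univ x)]
    linear_combination β ^ (k * x).val * (key x).2

end IsSetup

end

end Whiteman

/-! ### Gaussian periods in an arbitrary field -/

namespace Whiteman

section

variable {n₁ n₂ : ℕ} [Fact n₁.Prime] [Fact n₂.Prime] {g u : ℤ}

namespace IsSetup

variable (hs : IsSetup n₁ n₂ g u) [NeZero (n₁ * n₂)]
include hs

variable {K : Type*} [Field K] {β : K}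

omit hs [Fact n₁.Prime] [Fact n₂.Prime] in
theorem expSum_eq_intCast (hβ : IsPrimitiveRoot β (n₁ * n₂)) {S : Finset (ZMod (n₁ * n₂))}
    {k : ZMod (n₁ * n₂)} {c : ℤ}
    (h : ∀ ζ : ℂ, IsPrimitiveRoot ζ (n₁ * n₂) → expSum ζ S k = c) : expSum β S k = c := by
  have hζ := Complex.isPrimitiveRoot_exp (n₁ * n₂) (NeZero.ne _)
  have := aeval_eq_zero_of_complex hβ hζ (T := expPoly S k - C c) (by
    rw [map_sub, aeval_expPoly, h _ hζ, aeval_C, algebraMap_int_eq, eq_intCast, sub_self])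
  rwa [map_sub, aeval_expPoly, aeval_C, algebraMap_int_eq, eq_intCast, sub_eq_zero] at this

/-- Over `ℂ` the Gauss sum at a non-unit is zero, so both sums are half the sum over the units. The
integral value then passes to `K`, even in characteristic `2`. -/
theorem expSum_D_of_symbol_eq_zero (hβ : IsPrimitiveRoot β (n₁ * n₂)) {k : ZMod (n₁ * n₂)} {c : ℤ}
    (hk : symbol n₁ n₂ k = 0)
    (h : ∀ ζ : ℂ, IsPrimitiveRoot ζ (n₁ * n₂) → expSum ζ Finset.univ k -
      expSum ζ (ker₁ n₁ n₂) k - expSum ζ (ker₂ n₁ n₂) k + 1 = 2 * c) :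
    expSum β (D₁ n₁ n₂ g u) k = c ∧ expSum β (D₀ n₁ n₂ g u) k = c := by
  constructor <;> refine expSum_eq_intCast hβ fun ζ hζ => ?_
  · have h1 := (hs.expSum_D_aux (β := ζ) k).1
    rw [h ζ hζ, hs.gauss_eq_zero hk, sub_zero] at h1
    exact mul_left_cancel₀ two_ne_zero h1
  · have h1 := (hs.expSum_D_aux (β := ζ) k).2
    rw [h ζ hζ, hs.gauss_eq_zero hk, add_zero] at h1
    exact mul_left_cancel₀ two_ne_zero h1

omit [Fact n₁.Prime] [Fact n₂.Prime] [NeZero (n₁ * n₂)] in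
theorem two_mul_half₁ : 2 * ((n₁ - 1) / 2) + 1 = n₁ := by
  obtain ⟨k, hk⟩ := hs.odd₁
  omega

omit [Fact n₁.Prime] [Fact n₂.Prime] [NeZero (n₁ * n₂)] in
theorem two_mul_half₂ : 2 * ((n₂ - 1) / 2) + 1 = n₂ := by
  obtain ⟨k, hk⟩ := hs.odd₂
  omega

theorem expSum_D₁_of_red₁ (hβ : IsPrimitiveRoot β (n₁ * n₂)) {k : ZMod (n₁ * n₂)}
    (h1 : red₁ n₁ n₂ k = 0) (h2 : red₂ n₁ n₂ k ≠ 0) :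
    expSum β (D₁ n₁ n₂ g u) k = -((n₁ - 1) / 2 : ℕ) := by
  have := (hs.expSum_D_of_symbol_eq_zero hβ (k := k) (c := -((n₁ - 1) / 2 : ℕ))
    ((symbol_eq_zero_iff k).2 (Or.inl h1)) fun ζ hζ => ?_).1
  · rw [this, Int.cast_neg, Int.cast_natCast]
  · rw [expSum_univ_of_ne_zero hζ (by rintro rfl; simp at h2), hs.expSum_ker₁_of_ne hζ h2,
      hs.expSum_ker₂_of_eq h1]
    have h3 := congrArg (Nat.cast (R := ℂ)) hs.two_mul_half₁
    push_cast at h3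
    rw [Int.cast_neg, Int.cast_natCast]
    linear_combination h3

theorem expSum_D₁_of_red₂ (hβ : IsPrimitiveRoot β (n₁ * n₂)) {k : ZMod (n₁ * n₂)}
    (h1 : red₁ n₁ n₂ k ≠ 0) (h2 : red₂ n₁ n₂ k = 0) :
    expSum β (D₁ n₁ n₂ g u) k = -((n₂ - 1) / 2 : ℕ) := by
  have := (hs.expSum_D_of_symbol_eq_zero hβ (k := k) (c := -((n₂ - 1) / 2 : ℕ))
    ((symbol_eq_zero_iff k).2 (Or.inr h2)) fun ζ hζ => ?_).1
  · rw [this, Int.cast_neg, Int.cast_natCast]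
  · rw [expSum_univ_of_ne_zero hζ (by rintro rfl; simp at h1), hs.expSum_ker₂_of_ne hζ h1,
      hs.expSum_ker₁_of_eq h2]
    have h3 := congrArg (Nat.cast (R := ℂ)) hs.two_mul_half₂
    push_cast at h3
    rw [Int.cast_neg, Int.cast_natCast]
    linear_combination h3

theorem expSum_D_zero (hβ : IsPrimitiveRoot β (n₁ * n₂)) :
    expSum β (D₁ n₁ n₂ g u) 0 = ((n₁ - 1) / 2 * (n₂ - 1) : ℕ) ∧
      expSum β (D₀ n₁ n₂ g u) 0 = ((n₁ - 1) / 2 * (n₂ - 1) : ℕ) := by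
  have := hs.expSum_D_of_symbol_eq_zero hβ (k := 0) (c := ((n₁ - 1) / 2 * (n₂ - 1) : ℕ))
    ((symbol_eq_zero_iff _).2 (Or.inl (map_zero _))) fun ζ hζ => ?_
  · simpa only [Int.cast_natCast] using this
  · rw [expSum_univ_zero, hs.expSum_ker₁_of_eq (map_zero _), hs.expSum_ker₂_of_eq (map_zero _)]
    have h3 := congrArg (Nat.cast (R := ℂ)) hs.two_mul_half₁
    have h4 : ((n₂ - 1 : ℕ) : ℂ) = n₂ - 1 := Nat.cast_pred (Fact.out : n₂.Prime).pos
    push_cast at h3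
    rw [Int.cast_natCast, Nat.cast_mul, Nat.cast_mul, h4]
    linear_combination (-(n₂ : ℂ) + 1) * h3

theorem card_D₁ : (D₁ n₁ n₂ g u).card = (n₁ - 1) / 2 * (n₂ - 1) := by
  have h := (hs.expSum_D_zero (Complex.isPrimitiveRoot_exp (n₁ * n₂) (NeZero.ne _))).1
  rw [expSum_eq_card (by simp)] at h
  exact_mod_cast h

theorem card_D₀ : (D₀ n₁ n₂ g u).card = (n₁ - 1) / 2 * (n₂ - 1) := by
  have h := (hs.expSum_D_zero (Complex.isPrimitiveRoot_exp (n₁ * n₂) (NeZero.ne _))).2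
  rw [expSum_eq_card (by simp)] at h
  exact_mod_cast h

omit hs [NeZero (n₁ * n₂)] in
theorem red_one_ne_zero : red₁ n₁ n₂ 1 ≠ 0 ∧ red₂ n₁ n₂ 1 ≠ 0 := by
  rw [map_one, map_one]
  exact ⟨one_ne_zero, one_ne_zero⟩

theorem expSum_D_one (hβ : IsPrimitiveRoot β (n₁ * n₂)) :
    2 * expSum β (D₁ n₁ n₂ g u) 1 = 1 - gauss β (1 : ZMod (n₁ * n₂)) ∧
      2 * expSum β (D₀ n₁ n₂ g u) 1 = 1 + gauss β (1 : ZMod (n₁ * n₂)) := by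
  have h := hs.expSum_D_aux (β := β) 1
  have h1 := red_one_ne_zero (n₁ := n₁) (n₂ := n₂)
  rw [expSum_univ_of_ne_zero hβ (fun h0 => h1.1 (by rw [h0, map_zero])),
    hs.expSum_ker₁_of_ne hβ h1.2, hs.expSum_ker₂_of_ne hβ h1.1] at h
  simpa using h

/-- The two Gaussian periods add up to `1`. -/
theorem expSum_D₀_add_expSum_D₁ (hβ : IsPrimitiveRoot β (n₁ * n₂)) :
    expSum β (D₀ n₁ n₂ g u) 1 + expSum β (D₁ n₁ n₂ g u) 1 = 1 := by
  have hζ := Complex.isPrimitiveRoot_exp (n₁ * n₂) (NeZero.ne _)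
  have := aeval_eq_zero_of_complex hβ hζ
    (T := expPoly (D₀ n₁ n₂ g u) 1 + expPoly (D₁ n₁ n₂ g u) 1 - 1) (by
      rw [map_sub, map_add, aeval_expPoly, aeval_expPoly, map_one]
      obtain ⟨h1, h2⟩ := hs.expSum_D_one hζ
      linear_combination (h1 + h2) / 2)
  rw [map_sub, map_add, aeval_expPoly, aeval_expPoly, map_one] at this
  exact sub_eq_zero.1 this

/-- The product of the two Gaussian periods. -/
theorem expSum_D₀_mul_expSum_D₁ (hβ : IsPrimitiveRoot β (n₁ * n₂)) {c : ℤ}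
    (hc : 4 * c = 1 - ZMod.χ₄ (n₁ * n₂ : ℕ) * (n₁ * n₂ : ℕ)) :
    expSum β (D₀ n₁ n₂ g u) 1 * expSum β (D₁ n₁ n₂ g u) 1 = c := by
  have hζ := Complex.isPrimitiveRoot_exp (n₁ * n₂) (NeZero.ne _)
  have := aeval_eq_zero_of_complex hβ hζ
    (T := expPoly (D₀ n₁ n₂ g u) 1 * expPoly (D₁ n₁ n₂ g u) 1 - C c) (by
      rw [map_sub, map_mul, aeval_expPoly, aeval_expPoly, aeval_C, algebraMap_int_eq, eq_intCast]
      obtain ⟨h1, h2⟩ := hs.expSum_D_one hζ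
      have h3 := hs.gauss_sq hζ
      have h4 := congrArg (Int.cast (R := ℂ)) hc
      rw [← hs.symbol_neg_one] at h4
      have h5 : ((symbol n₁ n₂ (-1) : ℤ) : ℂ) ^ 2 = 1 := by
        rw [← Int.cast_pow, ← map_pow, neg_one_sq, map_one, Int.cast_one]
      simp only [Int.cast_mul, Int.cast_sub, Int.cast_one, Int.cast_natCast, Int.cast_ofNat] at h4
      linear_combination 1 / 4 * (2 * expSum _ (D₁ n₁ n₂ g u) 1 * h2 +
        (1 + gauss _ (1 : ZMod (n₁ * n₂))) * h1 - h4 -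
        (symbol n₁ n₂ (-1) : ℂ) * h3 + gauss _ (1 : ZMod (n₁ * n₂)) ^ 2 * h5))
  rw [map_sub, map_mul, aeval_expPoly, aeval_expPoly, aeval_C, algebraMap_int_eq, eq_intCast] at this
  exact sub_eq_zero.1 this

theorem expSum_D₁_of_symbol_eq_one {k : ZMod (n₁ * n₂)} (hk : symbol n₁ n₂ k = 1) :
    expSum β (D₁ n₁ n₂ g u) k = expSum β (D₁ n₁ n₂ g u) 1 := by
  have hu := hs.isUnit_of_symbol_ne_zero (x := k) (by rw [hk]; exact one_ne_zero)
  rw [← expSum_mul_unit (k := 1) hu (S := D₁ n₁ n₂ g u), one_mul]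
  intro x
  rw [hs.mem_D₁, hs.mem_D₁, map_mul, hk, one_mul]

theorem expSum_D₁_of_symbol_eq_neg_one {k : ZMod (n₁ * n₂)} (hk : symbol n₁ n₂ k = -1) :
    expSum β (D₁ n₁ n₂ g u) k = expSum β (D₀ n₁ n₂ g u) 1 := by
  have hu := hs.isUnit_of_symbol_ne_zero (x := k) (by rw [hk]; norm_num)
  rw [← expSum_mul_unit (k := 1) hu (S := D₁ n₁ n₂ g u), one_mul]
  intro x
  rw [hs.mem_D₁, hs.mem_D₀, map_mul, hk]
  omega

theorem P_eq_erase : P n₁ n₂ = (ker₁ n₁ n₂).erase 0 := by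
  ext x
  rw [hs.mem_P, Finset.mem_erase, mem_ker₁, Ne, Ne, hs.eq_zero_iff x]
  tauto

theorem expSum_P (k : ZMod (n₁ * n₂)) :
    expSum β (P n₁ n₂) k = expSum β (ker₁ n₁ n₂) k - 1 := by
  have h := Finset.add_sum_erase (ker₁ n₁ n₂) (fun x => β ^ (k * x).val)
    (a := 0) ((mem_ker₁ _).2 (map_zero _))
  rw [mul_zero, ZMod.val_zero, pow_zero] at h
  rw [hs.P_eq_erase, expSum, expSum, ← h]
  ring

omit [NeZero (n₁ * n₂)] in
theorem disjoint_P_D₁ : Disjoint (P n₁ n₂) (D₁ n₁ n₂ g u) := by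
  rw [Finset.disjoint_left]
  intro x hx hx'
  rw [hs.mem_P] at hx
  rw [hs.mem_D₁, (symbol_eq_zero_iff x).2 (Or.inl hx.1)] at hx'
  norm_num at hx'

/-! ### The values of `Λ` at the `n`-th roots of unity -/

variable {F : Type*} [Field F] [Algebra F K]

theorem aeval_Lam (hβ : IsPrimitiveRoot β (n₁ * n₂)) (k : ZMod (n₁ * n₂)) :
    aeval (β ^ k.val) (Lam F n₁ n₂ g u) =
      expSum β (ker₁ n₁ n₂) k - 1 + expSum β (D₁ n₁ n₂ g u) k := by
  rw [← hs.expSum_P, expSum, expSum, ← Finset.sum_union hs.disjoint_P_D₁, Lam, map_sum]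
  refine Finset.sum_congr rfl fun x _ => ?_
  rw [map_pow, aeval_X, hβ.pow_val_mul]

theorem aeval_Lam_zero (hβ : IsPrimitiveRoot β (n₁ * n₂)) :
    aeval (β ^ (0 : ZMod (n₁ * n₂)).val) (Lam F n₁ n₂ g u) =
      ((n₁ + 1) * (n₂ - 1) / 2 : ℕ) := by
  rw [hs.aeval_Lam hβ, hs.expSum_ker₁_of_eq (map_zero _), (hs.expSum_D_zero hβ).1]
  have h1 : (n₁ + 1) * (n₂ - 1) / 2 = ((n₁ - 1) / 2 + 1) * (n₂ - 1) := by
    conv_lhs => rw [← hs.two_mul_half₁]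
    rw [show 2 * ((n₁ - 1) / 2) + 1 + 1 = 2 * ((n₁ - 1) / 2 + 1) by ring, mul_assoc,
      Nat.mul_div_cancel_left _ two_pos]
  have h4 : ((n₂ - 1 : ℕ) : K) = n₂ - 1 := Nat.cast_pred (Fact.out : n₂.Prime).pos
  rw [h1, add_mul, one_mul, Nat.cast_add, h4]
  ring

theorem aeval_Lam_of_red₁ (hβ : IsPrimitiveRoot β (n₁ * n₂)) {k : ZMod (n₁ * n₂)}
    (h1 : red₁ n₁ n₂ k = 0) (h2 : red₂ n₁ n₂ k ≠ 0) :
    aeval (β ^ k.val) (Lam F n₁ n₂ g u) = -((n₁ + 1) / 2 : ℕ) := by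
  rw [hs.aeval_Lam hβ, hs.expSum_ker₁_of_ne hβ h2, hs.expSum_D₁_of_red₁ hβ h1 h2]
  have h3 : (n₁ + 1) / 2 = (n₁ - 1) / 2 + 1 := by
    have := hs.two_mul_half₁
    omega
  rw [h3]
  push_cast
  ring

theorem aeval_Lam_of_red₂ (hβ : IsPrimitiveRoot β (n₁ * n₂)) {k : ZMod (n₁ * n₂)}
    (h1 : red₁ n₁ n₂ k ≠ 0) (h2 : red₂ n₁ n₂ k = 0) :
    aeval (β ^ k.val) (Lam F n₁ n₂ g u) = ((n₂ - 1) / 2 : ℕ) := by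
  rw [hs.aeval_Lam hβ, hs.expSum_ker₁_of_eq h2, hs.expSum_D₁_of_red₂ hβ h1 h2]
  have h3 := congrArg (Nat.cast (R := K)) hs.two_mul_half₂
  push_cast at h3 ⊢
  linear_combination -h3

theorem aeval_Lam_of_symbol_eq_one (hβ : IsPrimitiveRoot β (n₁ * n₂)) {k : ZMod (n₁ * n₂)}
    (hk : symbol n₁ n₂ k = 1) :
    aeval (β ^ k.val) (Lam F n₁ n₂ g u) = -expSum β (D₀ n₁ n₂ g u) 1 := by
  have h : red₂ n₁ n₂ k ≠ 0 := fun h => by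
    rw [(symbol_eq_zero_iff k).2 (Or.inr h)] at hk
    norm_num at hk
  rw [hs.aeval_Lam hβ, hs.expSum_ker₁_of_ne hβ h, hs.expSum_D₁_of_symbol_eq_one hk]
  linear_combination hs.expSum_D₀_add_expSum_D₁ hβ

theorem aeval_Lam_of_symbol_eq_neg_one (hβ : IsPrimitiveRoot β (n₁ * n₂)) {k : ZMod (n₁ * n₂)}
    (hk : symbol n₁ n₂ k = -1) :
    aeval (β ^ k.val) (Lam F n₁ n₂ g u) = -expSum β (D₁ n₁ n₂ g u) 1 := by
  have h : red₂ n₁ n₂ k ≠ 0 := fun h => by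
    rw [(symbol_eq_zero_iff k).2 (Or.inr h)] at hk
    norm_num at hk
  rw [hs.aeval_Lam hβ, hs.expSum_ker₁_of_ne hβ h, hs.expSum_D₁_of_symbol_eq_neg_one hk]
  linear_combination hs.expSum_D₀_add_expSum_D₁ hβ

theorem aeval_Lam_self (hβ : IsPrimitiveRoot β (n₁ * n₂)) :
    aeval β (Lam F n₁ n₂ g u) = -expSum β (D₀ n₁ n₂ g u) 1 := by
  have h := hs.aeval_Lam_of_symbol_eq_one (F := F) hβ (k := ((1 : ℕ) : ZMod (n₁ * n₂)))
    (by rw [Nat.cast_one, map_one])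
  rwa [hβ.pow_val_natCast, pow_one] at h

open scoped Classical in
/-- The polynomial whose roots are the common zeros of `x^n - 1` and `Λ(x)`. -/
theorem map_genPoly_Lam_mul (hβ : IsPrimitiveRoot β (n₁ * n₂)) :
    (genPoly (n₁ * n₂) (Lam F n₁ n₂ g u)).map (algebraMap F K) *
      ((if (((n₁ + 1) * (n₂ - 1) / 2 : ℕ) : K) = 0 then X - 1 else 1) *
      (if (((n₁ + 1) / 2 : ℕ) : K) = 0 then rootPoly β (P n₁ n₂) else 1) *
      (if (((n₂ - 1) / 2 : ℕ) : K) = 0 then rootPoly β ((ker₂ n₁ n₂).erase 0) else 1) *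
      ((if expSum β (D₀ n₁ n₂ g u) 1 = 0 then rootPoly β (D₀ n₁ n₂ g u) else 1) *
      (if expSum β (D₁ n₁ n₂ g u) 1 = 0 then rootPoly β (D₁ n₁ n₂ g u) else 1))) =
      X ^ (n₁ * n₂) - 1 := by
  rw [← map_genPoly_mul_rootPoly hβ (Lam F n₁ n₂ g u)
    (S := Finset.univ.filter fun x => aeval (β ^ x.val) (Lam F n₁ n₂ g u) = 0) (by simp)]
  congr 1
  symm
  rw [rootPoly, Finset.prod_filter]
  set f : ZMod (n₁ * n₂) → K[X] := fun x =>
    if aeval (β ^ x.val) (Lam F n₁ n₂ g u) = 0 then X - C (β ^ x.val) else 1 with hf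
  -- The five sets partition the residues, so exactly one factor on the right is `f x`.
  have hsplit : ∀ x, f x = (if x ∈ ({0} : Finset (ZMod (n₁ * n₂))) then f x else 1) *
      (if x ∈ P n₁ n₂ then f x else 1) * (if x ∈ (ker₂ n₁ n₂).erase 0 then f x else 1) *
      ((if x ∈ D₀ n₁ n₂ g u then f x else 1) * (if x ∈ D₁ n₁ n₂ g u then f x else 1)) := by
    intro x
    simp only [Finset.mem_singleton, hs.mem_P, Finset.mem_erase, mem_ker₂, hs.mem_D₀, hs.mem_D₁]
    by_cases h1 : red₁ n₁ n₂ x = 0 <;> by_cases h2 : red₂ n₁ n₂ x = 0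
    · have h3 := (symbol_eq_zero_iff x).2 (Or.inl h1)
      have h4 := (hs.eq_zero_iff x).2 ⟨h1, h2⟩
      subst h4
      simp [h3]
    · have h3 := (symbol_eq_zero_iff x).2 (Or.inl h1)
      have h4 : x ≠ 0 := fun h => h2 ((hs.eq_zero_iff x).1 h).2
      simp [h1, h2, h3, h4]
    · have h3 := (symbol_eq_zero_iff x).2 (Or.inr h2)
      have h4 : x ≠ 0 := fun h => h1 ((hs.eq_zero_iff x).1 h).1
      simp [h1, h2, h3, h4]
    · have h3 : symbol n₁ n₂ x ≠ 0 := fun h => ((symbol_eq_zero_iff x).1 h).elim h1 h2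
      have h4 : x ≠ 0 := fun h => h1 ((hs.eq_zero_iff x).1 h).1
      rcases symbol_trichotomy x with h | h | h
      · exact absurd h h3
      · simp [h1, h2, h, h4]
      · simp [h1, h2, h, h4]
  have hconst : ∀ (S : Finset (ZMod (n₁ * n₂))) (a : K),
      (∀ x ∈ S, aeval (β ^ x.val) (Lam F n₁ n₂ g u) = 0 ↔ a = 0) →
      (∏ x, if x ∈ S then f x else 1) = if a = 0 then rootPoly β S else 1 := by
    intro S a ha
    rw [Finset.prod_ite_mem, Finset.univ_inter]
    split_ifs with h
    · refine Finset.prod_congr rfl fun x hx => ?_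
      rw [hf]
      exact if_pos ((ha x hx).2 h)
    · refine Finset.prod_eq_one fun x hx => ?_
      rw [hf]
      exact if_neg fun h' => h ((ha x hx).1 h')
  rw [Finset.prod_congr rfl fun x _ => hsplit x]
  simp only [Finset.prod_mul_distrib]
  rw [hconst {0} (((n₁ + 1) * (n₂ - 1) / 2 : ℕ) : K), hconst (P n₁ n₂) (((n₁ + 1) / 2 : ℕ) : K),
    hconst ((ker₂ n₁ n₂).erase 0) (((n₂ - 1) / 2 : ℕ) : K),
    hconst _ (expSum β (D₀ n₁ n₂ g u) 1), hconst _ (expSum β (D₁ n₁ n₂ g u) 1)]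
  · congr 4
    simp [rootPoly]
  · intro x hx
    rw [hs.aeval_Lam_of_symbol_eq_neg_one hβ ((hs.mem_D₁ x).1 hx), neg_eq_zero]
  · intro x hx
    rw [hs.aeval_Lam_of_symbol_eq_one hβ ((hs.mem_D₀ x).1 hx), neg_eq_zero]
  · intro x hx
    rw [Finset.mem_erase, mem_ker₂] at hx
    rw [hs.aeval_Lam_of_red₂ hβ (fun h => hx.1 ((hs.eq_zero_iff x).2 ⟨h, hx.2⟩)) hx.2]
  · intro x hx
    rw [hs.mem_P] at hx
    rw [hs.aeval_Lam_of_red₁ hβ hx.1 hx.2, neg_eq_zero]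
  · intro x hx
    rw [Finset.mem_singleton.1 hx, hs.aeval_Lam_zero hβ]

theorem rootPoly_P_mul (hβ : IsPrimitiveRoot β (n₁ * n₂)) :
    rootPoly β (P n₁ n₂) * (X - 1) = X ^ n₂ - 1 := by
  rw [← hs.rootPoly_ker₁ hβ, hs.P_eq_erase, rootPoly, rootPoly,
    ← Finset.prod_erase_mul (ker₁ n₁ n₂) _ ((mem_ker₁ 0).2 (map_zero _))]
  simp

theorem rootPoly_ker₂_erase_mul (hβ : IsPrimitiveRoot β (n₁ * n₂)) :
    rootPoly β ((ker₂ n₁ n₂).erase 0) * (X - 1) = X ^ n₁ - 1 := by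
  rw [← hs.rootPoly_ker₂ hβ, rootPoly, rootPoly,
    ← Finset.prod_erase_mul (ker₂ n₁ n₂) _ ((mem_ker₂ 0).2 (map_zero _))]
  simp

end IsSetup

end

-- The root `1` belongs to both `x^{n₁} - 1` and `x^{n₂} - 1`. The implications `h₁`, `h₂` supply
-- the factor `x - 1` that completes `p` or `q`; when both occur it is available only once, so the
-- last quotient carries an extra `x - 1` in the numerator.
open scoped Classical in
theorem isQuotient_table {K : Type*} [Field K] {G d p q : K[X]} {N n₁ n₂ : ℕ} (hN : N ≠ 0)
    (hn₁ : n₁ ≠ 0) (hn₂ : n₂ ≠ 0) (hd : d ≠ 0) {A A₁ A₂ : Prop} (h₁ : A₁ → A) (h₂ : A₂ → A)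
    (hp : p * (X - 1) = X ^ n₂ - 1) (hq : q * (X - 1) = X ^ n₁ - 1)
    (h : G * ((if A then X - 1 else 1) * (if A₁ then p else 1) * (if A₂ then q else 1) * d) =
      X ^ N - 1) :
    (¬A₁ → ¬A₂ → ¬A → IsQuotient G (X ^ N - 1) d ∧ G.natDegree + d.natDegree = N) ∧
    (¬A₁ → ¬A₂ → A → IsQuotient G (X ^ N - 1) ((X - 1) * d) ∧
      G.natDegree + (1 + d.natDegree) = N) ∧
    (A₁ → ¬A₂ → IsQuotient G (X ^ N - 1) ((X ^ n₂ - 1) * d) ∧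
      G.natDegree + (n₂ + d.natDegree) = N) ∧
    (¬A₁ → A₂ → IsQuotient G (X ^ N - 1) ((X ^ n₁ - 1) * d) ∧
      G.natDegree + (n₁ + d.natDegree) = N) ∧
    (A₁ → A₂ → IsQuotient G ((X ^ N - 1) * (X - 1)) ((X ^ n₁ - 1) * (X ^ n₂ - 1) * d) ∧
      G.natDegree + (n₁ + n₂ + d.natDegree) = N + 1) := by
  have hX : (X - 1 : K[X]) ≠ 0 := X_sub_C_ne_zero 1
  have hdX : (X - 1 : K[X]).natDegree = 1 := natDegree_X_sub_C 1
  have hdeg : ∀ m : ℕ, (X ^ m - 1 : K[X]).natDegree = m := fun m => by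
    rw [← C_1, natDegree_X_pow_sub_C]
  have hX₁ := X_pow_sub_one_ne_zero (F := K) hn₁
  have hX₂ := X_pow_sub_one_ne_zero (F := K) hn₂
  have hXN := X_pow_sub_one_ne_zero (F := K) hN
  refine ⟨fun a₁ a₂ a => ?_, fun a₁ a₂ a => ?_, fun a₁ a₂ => ?_, fun a₁ a₂ => ?_, fun a₁ a₂ => ?_⟩
  · have hQ : IsQuotient G (X ^ N - 1) d := ⟨hd, by rw [← h]; simp [a₁, a₂, a]⟩
    refine ⟨hQ, ?_⟩
    rw [hQ.natDegree_add hXN, hdeg]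
  · have hQ : IsQuotient G (X ^ N - 1) ((X - 1) * d) :=
      ⟨mul_ne_zero hX hd, by rw [← h]; simp [a₁, a₂, a]⟩
    refine ⟨hQ, ?_⟩
    rw [← hdeg N, ← hQ.natDegree_add hXN, natDegree_mul hX hd, hdX]
  · have a := h₁ a₁
    have hQ : IsQuotient G (X ^ N - 1) ((X ^ n₂ - 1) * d) :=
      ⟨mul_ne_zero hX₂ hd, by rw [← h, ← hp]; simp only [a₁, a₂, a, if_true, if_false]; ring⟩
    refine ⟨hQ, ?_⟩
    rw [← hdeg N, ← hQ.natDegree_add hXN, natDegree_mul hX₂ hd, hdeg]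
  · have a := h₂ a₂
    have hQ : IsQuotient G (X ^ N - 1) ((X ^ n₁ - 1) * d) :=
      ⟨mul_ne_zero hX₁ hd, by rw [← h, ← hq]; simp only [a₁, a₂, a, if_true, if_false]; ring⟩
    refine ⟨hQ, ?_⟩
    rw [← hdeg N, ← hQ.natDegree_add hXN, natDegree_mul hX₁ hd, hdeg]
  · have a := h₁ a₁
    have hQ : IsQuotient G ((X ^ N - 1) * (X - 1)) ((X ^ n₁ - 1) * (X ^ n₂ - 1) * d) :=
      ⟨mul_ne_zero (mul_ne_zero hX₁ hX₂) hd, by rw [← h, ← hp, ← hq]; simp only [a₁, a₂, a, if_true]; ring⟩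
    refine ⟨hQ, ?_⟩
    have h3 := hQ.natDegree_add (mul_ne_zero hXN hX)
    rwa [natDegree_mul hXN hX, natDegree_mul (mul_ne_zero hX₁ hX₂) hd, natDegree_mul hX₁ hX₂,
      hdeg, hdeg, hdeg, hdX] at h3

end Whiteman

/-! ### The sequence polynomial, the period product and Frobenius -/

namespace Whiteman

theorem sum_seq_eq_Lam (F : Type*) [Field F] (n₁ n₂ : ℕ) [NeZero (n₁ * n₂)] (g u : ℤ) :
    ∑ i ∈ Finset.range (n₁ * n₂), C (seq F n₁ n₂ g u i) * X ^ i = Lam F n₁ n₂ g u := by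
  have h : ∀ i : ℕ, C (seq F n₁ n₂ g u i) * X ^ i =
      if (i : ZMod (n₁ * n₂)) ∈ C₁ n₁ n₂ g u then X ^ i else 0 := fun i => by
    rw [seq]
    split_ifs <;> simp
  rw [Finset.sum_congr rfl fun i _ => h i, ← Finset.sum_filter, Lam]
  refine Finset.sum_nbij' (fun i => (i : ZMod (n₁ * n₂))) (fun x => x.val) ?_ ?_ ?_ ?_ ?_
  · intro i hi
    exact (Finset.mem_filter.1 hi).2
  · intro x hx
    rw [Finset.mem_filter, Finset.mem_range, ZMod.natCast_zmod_val]
    exact ⟨ZMod.val_lt x, hx⟩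
  · intro i hi
    exact ZMod.val_cast_of_lt (Finset.mem_range.1 (Finset.mem_filter.1 hi).1)
  · intro x _
    exact ZMod.natCast_zmod_val x
  · intro i hi
    rw [ZMod.val_cast_of_lt (Finset.mem_range.1 (Finset.mem_filter.1 hi).1)]

theorem seq_add_period (F : Type*) [Field F] (n₁ n₂ : ℕ) (g u : ℤ) (j : ℕ) :
    seq F n₁ n₂ g u (j + n₁ * n₂) = seq F n₁ n₂ g u j := by
  rw [seq, seq, Nat.cast_add, ZMod.natCast_self, add_zero]

section

variable {n₁ n₂ : ℕ} [Fact n₁.Prime] [Fact n₂.Prime] {g u : ℤ}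

namespace IsSetup

variable (hs : IsSetup n₁ n₂ g u) [NeZero (n₁ * n₂)]
include hs

variable {K : Type*} [Field K] {β : K}

theorem expSum_mul_of_mod_seven (hβ : IsPrimitiveRoot β (n₁ * n₂)) (h : n₁ * n₂ ≡ 7 [MOD 12]) :
    expSum β (D₀ n₁ n₂ g u) 1 * expSum β (D₁ n₁ n₂ g u) 1 = ((n₁ * n₂ + 1) / 4 : ℕ) := by
  rw [Nat.ModEq] at h
  have := hs.expSum_D₀_mul_expSum_D₁ hβ (c := ((n₁ * n₂ + 1) / 4 : ℕ)) (by
    rw [ZMod.χ₄_nat_three_mod_four (by omega)]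
    omega)
  rwa [Int.cast_natCast] at this

theorem expSum_mul_of_mod_one (hβ : IsPrimitiveRoot β (n₁ * n₂)) (h : n₁ * n₂ ≡ 1 [MOD 12]) :
    expSum β (D₀ n₁ n₂ g u) 1 * expSum β (D₁ n₁ n₂ g u) 1 = -((n₁ * n₂ - 1) / 4 : ℕ) := by
  rw [Nat.ModEq] at h
  have := hs.expSum_D₀_mul_expSum_D₁ hβ (c := -((n₁ * n₂ - 1) / 4 : ℕ)) (by
    rw [ZMod.χ₄_nat_one_mod_four (by omega)]
    omega)
  rwa [Int.cast_neg, Int.cast_natCast] at this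

variable {F : Type*} [Field F] [Fintype F] [Algebra F K]

/-- Here `Λ(β) = -η₀` is `0` or `-1`, so `Λ(β^q) = Λ(β)^q = Λ(β)`. If `q` had symbol `-1`, this
would say `η₁ = η₀`, impossible for periods with sum `1` and product `0`. -/
theorem card_mem_D₀ (hβ : IsPrimitiveRoot β (n₁ * n₂))
    (hq : Nat.Coprime (n₁ * n₂) (Fintype.card F))
    (h : expSum β (D₀ n₁ n₂ g u) 1 * expSum β (D₁ n₁ n₂ g u) 1 = 0) :
    (Fintype.card F : ZMod (n₁ * n₂)) ∈ D₀ n₁ n₂ g u := by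
  have hadd := hs.expSum_D₀_add_expSum_D₁ hβ
  have hself := hs.aeval_Lam_self (F := F) hβ
  have hfrob : aeval (β ^ (Fintype.card F : ZMod (n₁ * n₂)).val) (Lam F n₁ n₂ g u) =
      aeval β (Lam F n₁ n₂ g u) := by
    rw [hβ.pow_val_natCast, ← expand_aeval, FiniteField.expand_card, map_pow, hself]
    rcases mul_eq_zero.1 h with h0 | h0
    · rw [h0, neg_zero, zero_pow Fintype.card_ne_zero]
    · rw [h0, add_zero] at hadd
      have h2 := congrArg (algebraMap F K) (FiniteField.pow_card (-1 : F))
      rwa [map_pow, map_neg, map_one, ← hadd] at h2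
  have hu : IsUnit (Fintype.card F : ZMod (n₁ * n₂)) :=
    (ZMod.isUnit_iff_coprime _ _).2 hq.symm
  have h0 : symbol n₁ n₂ (Fintype.card F : ZMod (n₁ * n₂)) ≠ 0 := by
    rw [Ne, symbol_eq_zero_iff, not_or]
    exact ⟨(hu.map (red₁ n₁ n₂)).ne_zero, (hu.map (red₂ n₁ n₂)).ne_zero⟩
  rw [hs.mem_D₀]
  rcases symbol_trichotomy (Fintype.card F : ZMod (n₁ * n₂)) with h1 | h1 | h1
  · exact absurd h1 h0
  · exact h1
  · rw [hs.aeval_Lam_of_symbol_eq_neg_one hβ h1, hself, neg_inj] at hfrob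
    rw [hfrob, mul_self_eq_zero] at h
    rw [hfrob, h, add_zero] at hadd
    exact absurd hadd zero_ne_one

theorem rootPoly_D_lifts (hβ : IsPrimitiveRoot β (n₁ * n₂))
    (hq : Nat.Coprime (n₁ * n₂) (Fintype.card F))
    (h : (Fintype.card F : ZMod (n₁ * n₂)) ∈ D₀ n₁ n₂ g u) :
    rootPoly β (D₀ n₁ n₂ g u) ∈ lifts (algebraMap F K) ∧
      rootPoly β (D₁ n₁ n₂ g u) ∈ lifts (algebraMap F K) := by
  have hu : IsUnit (Fintype.card F : ZMod (n₁ * n₂)) :=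
    (ZMod.isUnit_iff_coprime _ _).2 hq.symm
  rw [hs.mem_D₀] at h
  refine ⟨rootPoly_lifts hβ (fun x hx => ?_) hu, rootPoly_lifts hβ (fun x hx => ?_) hu⟩
  · rw [hs.mem_D₀] at hx ⊢
    rw [map_mul, h, hx, one_mul]
  · rw [hs.mem_D₁] at hx ⊢
    rw [map_mul, h, hx, one_mul]

end IsSetup

end

theorem isQuotient_of_map {F K : Type*} [Field F] [Field K] [Algebra F K] {G A B : F[X]}
    {A' B' : K[X]} (hA : A.map (algebraMap F K) = A') (hB : B.map (algebraMap F K) = B')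
    (h : IsQuotient (G.map (algebraMap F K)) A' B') : IsQuotient G A B := by
  subst hA hB
  refine ⟨?_, Polynomial.map_injective _ (algebraMap F K).injective ?_⟩
  · rintro rfl
    exact h.1 (by simp)
  · rw [Polynomial.map_mul]
    exact h.2

end Whiteman

/-! ### Assembly of the cases -/

theorem mainTheorem3
    {F : Type*} [Field F] [Fintype F] (p q : ℕ) [Fact p.Prime] [CharP F p]
    (hq : Fintype.card F = q)
    (n₁ n₂ n : ℕ) (hn₁ : n₁.Prime) (hn₂ : n₂.Prime) (hodd₁ : Odd n₁) (hodd₂ : Odd n₂)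
    (hne : n₁ ≠ n₂) (hn : n = n₁ * n₂)
    (hd : Whiteman.order n₁ n₂ = 6) (hnq : Nat.Coprime n q)
    (g u : ℤ) (hg₁ : IsPrimitiveRootMod g n₁) (hg₂ : IsPrimitiveRootMod g n₂)
    (hu₁ : u ≡ g [ZMOD n₁]) (hu₂ : u ≡ 1 [ZMOD n₂])
    {K : Type*} [Field K] [Algebra F K] (β : K) (hβ : IsPrimitiveRoot β n)
    (Δ₁ Δ₂ Δ : ZMod p)
    (hΔ₁ : Δ₁ = (((n₁ + 1) / 2 : ℕ) : ZMod p))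
    (hΔ₂ : Δ₂ = (((n₂ - 1) / 2 : ℕ) : ZMod p))
    (hΔ : Δ = (((n₁ + 1) * (n₂ - 1) / 2 : ℕ) : ZMod p))
    -- `gl` is the polynomial `g_λ`, `Lb` is the value `Λ(β)`, and `d₀`, `d₁` are over `K`
    (gl : F[X]) (hgl : gl = genPoly n (Whiteman.Lam F n₁ n₂ g u))
    (Lb : K) (hLb : Lb = aeval β (Whiteman.Lam F n₁ n₂ g u))
    (d₀ d₁ : K[X])
    (hd₀ : d₀ = Whiteman.rootPoly β (Whiteman.D₀ n₁ n₂ g u))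
    (hd₁ : d₁ = Whiteman.rootPoly β (Whiteman.D₁ n₁ n₂ g u)) :
    -- the cyclic code `C_λ`, its generator polynomial and its dimension
    (IsCyclicCode (codeOfSeq n (Whiteman.seq F n₁ n₂ g u)) ∧
      IsGeneratorPolynomial (codeOfSeq n (Whiteman.seq F n₁ n₂ g u)) gl ∧
      (Module.finrank F (codeOfSeq n (Whiteman.seq F n₁ n₂ g u)) : ℤ) = n - gl.natDegree) ∧
    ∃ L : ℕ, IsLinearSpan (Whiteman.seq F n₁ n₂ g u) L ∧
    -- case (1)
    ((n ≡ 7 [MOD 12] ∧ ¬ (n + 1) / 4 ≡ 0 [MOD p] ∨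
        n ≡ 1 [MOD 12] ∧ ¬ (n - 1) / 4 ≡ 0 [MOD p]) →
      (Δ₁ ≠ 0 → Δ₂ ≠ 0 → Δ ≠ 0 →
        gl = X ^ n - 1 ∧ L = n) ∧
      (Δ₁ ≠ 0 → Δ₂ ≠ 0 → Δ = 0 →
        IsQuotient gl (X ^ n - 1) (X - 1) ∧ (L : ℚ) = n - 1) ∧
      (Δ₁ = 0 → Δ₂ ≠ 0 →
        IsQuotient gl (X ^ n - 1) (X ^ n₂ - 1) ∧ (L : ℚ) = n - n₂) ∧
      (Δ₁ ≠ 0 → Δ₂ = 0 →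
        IsQuotient gl (X ^ n - 1) (X ^ n₁ - 1) ∧ (L : ℚ) = n - n₁) ∧
      (Δ₁ = 0 → Δ₂ = 0 →
        IsQuotient gl ((X ^ n - 1) * (X - 1)) ((X ^ n₁ - 1) * (X ^ n₂ - 1)) ∧
        (L : ℚ) = n - (n₁ + n₂ - 1))) ∧
    -- case (2)
    ((n ≡ 7 [MOD 12] ∧ (n + 1) / 4 ≡ 0 [MOD p] ∨
        n ≡ 1 [MOD 12] ∧ (n - 1) / 4 ≡ 0 [MOD p]) →
      (q : ZMod (n₁ * n₂)) ∈ Whiteman.D₀ n₁ n₂ g u ∧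
      d₀ ∈ Polynomial.lifts (algebraMap F K) ∧ d₁ ∈ Polynomial.lifts (algebraMap F K) ∧
      (Lb = 0 ∨ Lb = -1) ∧
      (Δ₁ ≠ 0 → Δ₂ ≠ 0 → Δ ≠ 0 →
        (Lb = 0 → IsQuotient (gl.map (algebraMap F K)) (X ^ n - 1) d₀) ∧
        (Lb = -1 → IsQuotient (gl.map (algebraMap F K)) (X ^ n - 1) d₁) ∧
        (L : ℚ) = n - ((n₁ - 1) * (n₂ - 1)) / 2) ∧
      (Δ₁ ≠ 0 → Δ₂ ≠ 0 → Δ = 0 →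
        (Lb = 0 → IsQuotient (gl.map (algebraMap F K)) (X ^ n - 1) ((X - 1) * d₀)) ∧
        (Lb = -1 → IsQuotient (gl.map (algebraMap F K)) (X ^ n - 1) ((X - 1) * d₁)) ∧
        (L : ℚ) = n - ((n₁ - 1) * (n₂ - 1) + 2) / 2) ∧
      (Δ₁ = 0 → Δ₂ ≠ 0 →
        (Lb = 0 → IsQuotient (gl.map (algebraMap F K)) (X ^ n - 1) ((X ^ n₂ - 1) * d₀)) ∧
        (Lb = -1 → IsQuotient (gl.map (algebraMap F K)) (X ^ n - 1) ((X ^ n₂ - 1) * d₁)) ∧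
        (L : ℚ) = n - ((n₁ + 1) * (n₂ - 1) + 2) / 2) ∧
      (Δ₁ ≠ 0 → Δ₂ = 0 →
        (Lb = 0 → IsQuotient (gl.map (algebraMap F K)) (X ^ n - 1) ((X ^ n₁ - 1) * d₀)) ∧
        (Lb = -1 → IsQuotient (gl.map (algebraMap F K)) (X ^ n - 1) ((X ^ n₁ - 1) * d₁)) ∧
        (L : ℚ) = n - ((n₁ - 1) * (n₂ + 1) + 2) / 2) ∧
      (Δ₁ = 0 → Δ₂ = 0 →
        (Lb = 0 → IsQuotient (gl.map (algebraMap F K)) ((X ^ n - 1) * (X - 1))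
          ((X ^ n₁ - 1) * (X ^ n₂ - 1) * d₀)) ∧
        (Lb = -1 → IsQuotient (gl.map (algebraMap F K)) ((X ^ n - 1) * (X - 1))
          ((X ^ n₁ - 1) * (X ^ n₂ - 1) * d₁)) ∧
        (L : ℚ) = n - ((n₁ + 1) * (n₂ + 1) - 2) / 2)) := by

  subst hn hq
  have : Fact n₁.Prime := ⟨hn₁⟩
  have : Fact n₂.Prime := ⟨hn₂⟩
  have : NeZero (n₁ * n₂) := ⟨mul_ne_zero hn₁.ne_zero hn₂.ne_zero⟩
  have hN : n₁ * n₂ ≠ 0 := NeZero.ne _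
  have hs : Whiteman.IsSetup n₁ n₂ g u := ⟨hodd₁, hodd₂, hne, hd, hg₁, hg₂, hu₁, hu₂⟩
  have hseq := Whiteman.sum_seq_eq_Lam F n₁ n₂ g u
  have hcode : codeOfSeq (n₁ * n₂) (Whiteman.seq F n₁ n₂ g u) = codeOf (n₁ * n₂) gl := by
    rw [codeOfSeq, hseq, hgl]
  have hgd : gl ∣ X ^ (n₁ * n₂) - 1 := hgl ▸ genPoly_dvd _ _
  have hspan : IsLinearSpan (Whiteman.seq F n₁ n₂ g u) gl.natDegree := by
    rw [hgl, ← hseq]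
    exact isLinearSpan_natDegree_genPoly hN (Whiteman.seq_add_period F n₁ n₂ g u)
  refine ⟨?_, gl.natDegree, hspan, ?_⟩
  · rw [hcode]
    refine ⟨isCyclicCode_codeOf hgd, ⟨hgl ▸ genPoly_monic hN _, hgd, rfl⟩, ?_⟩
    have h := finrank_codeOf hN hgd
    rw [eq_sub_iff_add_eq]
    exact_mod_cast h
  have : CharP K p := charP_of_injective_algebraMap (algebraMap F K).injective p
  -- `K` has characteristic `p`, so all conditions modulo `p` can be read in `K`.
  have hcast : ∀ m : ℕ, ((m : ℕ) : ZMod p) = 0 ↔ (m : K) = 0 := fun m => by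
    rw [ZMod.natCast_eq_zero_iff, CharP.cast_eq_zero_iff K p]
  have hmod : ∀ m : ℕ, m ≡ 0 [MOD p] ↔ (m : K) = 0 := fun m => by
    rw [Nat.modEq_zero_iff_dvd, CharP.cast_eq_zero_iff K p]
  have hhalf₁ := hs.two_mul_half₁
  have hhalf₂ := hs.two_mul_half₂
  -- As `Δ = Δ₁(n₂ - 1) = (n₁ + 1)Δ₂`, vanishing of `Δ₁` or `Δ₂` forces `Δ = 0`; hence the five
  -- cases are exhaustive.
  have h₁ : (((n₁ + 1) / 2 : ℕ) : K) = 0 → (((n₁ + 1) * (n₂ - 1) / 2 : ℕ) : K) = 0 := fun h => by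
    rw [← Nat.div_mul_right_comm (by omega), Nat.cast_mul, h, zero_mul]
  have h₂ : (((n₂ - 1) / 2 : ℕ) : K) = 0 → (((n₁ + 1) * (n₂ - 1) / 2 : ℕ) : K) = 0 := fun h => by
    rw [Nat.mul_div_assoc _ (by omega), Nat.cast_mul, h, mul_zero]
  have hE := hs.map_genPoly_Lam_mul (F := F) hβ
  rw [← hgl] at hE
  have hLb' := hs.aeval_Lam_self (F := F) hβ
  rw [← hLb] at hLb'
  have hadd := hs.expSum_D₀_add_expSum_D₁ hβ
  subst hΔ₁ hΔ₂ hΔ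
  simp only [ne_eq, hcast]
  constructor
  · intro hcase
    have hη : Whiteman.expSum β (Whiteman.D₀ n₁ n₂ g u) 1 *
        Whiteman.expSum β (Whiteman.D₁ n₁ n₂ g u) 1 ≠ 0 := by
      rcases hcase with ⟨h7, h⟩ | ⟨h7, h⟩
      · rwa [hs.expSum_mul_of_mod_seven hβ h7, Ne, ← hmod]
      · rwa [hs.expSum_mul_of_mod_one hβ h7, neg_ne_zero, Ne, ← hmod]
    rw [if_neg (left_ne_zero_of_mul hη), if_neg (right_ne_zero_of_mul hη), one_mul] at hE
    obtain ⟨t1, t2, t3, t4, t5⟩ := Whiteman.isQuotient_table hN hn₁.ne_zero hn₂.ne_zero one_ne_zero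
      h₁ h₂ (hs.rootPoly_P_mul hβ) (hs.rootPoly_ker₂_erase_mul hβ) hE
    simp only [natDegree_map, natDegree_one, add_zero, mul_one] at t1 t2 t3 t4 t5
    refine ⟨fun a₁ a₂ a => ?_, fun a₁ a₂ a => ?_, fun a₁ a₂ => ?_, fun a₁ a₂ => ?_,
      fun a₁ a₂ => ?_⟩
    · obtain ⟨hQ, hL⟩ := t1 a₁ a₂ a
      have hQ' := Whiteman.isQuotient_of_map (A := X ^ (n₁ * n₂) - 1) (B := 1) (by simp) (by simp) hQ
      exact ⟨by rw [← hQ'.2, mul_one], hL⟩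
    · obtain ⟨hQ, hL⟩ := t2 a₁ a₂ a
      refine ⟨Whiteman.isQuotient_of_map (by simp) (by simp) hQ, ?_⟩
      rw [← hL]
      push_cast
      ring
    · obtain ⟨hQ, hL⟩ := t3 a₁ a₂
      refine ⟨Whiteman.isQuotient_of_map (by simp) (by simp) hQ, ?_⟩
      rw [← hL]
      push_cast
      ring
    · obtain ⟨hQ, hL⟩ := t4 a₁ a₂
      refine ⟨Whiteman.isQuotient_of_map (by simp) (by simp) hQ, ?_⟩
      rw [← hL]
      push_cast
      ring
    · obtain ⟨hQ, hL⟩ := t5 a₁ a₂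
      refine ⟨Whiteman.isQuotient_of_map (by simp) (by simp) hQ, ?_⟩
      have hL' := congrArg (Nat.cast (R := ℚ)) hL
      push_cast at hL' ⊢
      linear_combination hL'
  · classical
    intro hcase
    have hη : Whiteman.expSum β (Whiteman.D₀ n₁ n₂ g u) 1 *
        Whiteman.expSum β (Whiteman.D₁ n₁ n₂ g u) 1 = 0 := by
      rcases hcase with ⟨h7, h⟩ | ⟨h7, h⟩
      · rwa [hs.expSum_mul_of_mod_seven hβ h7, ← hmod]
      · rwa [hs.expSum_mul_of_mod_one hβ h7, neg_eq_zero, ← hmod]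
    have hq := hs.card_mem_D₀ (F := F) hβ hnq hη
    have hlift := hs.rootPoly_D_lifts (F := F) hβ hnq hq
    rw [← hd₀, ← hd₁] at hlift
    -- One period is `0` and the other `1`, so a single factor `d` survives, of the same degree in
    -- either case.
    obtain ⟨hLb01, d, hdeq, hdne, hdeg, hLb0, hLb1⟩ : (Lb = 0 ∨ Lb = -1) ∧ ∃ d : K[X],
        ((if Whiteman.expSum β (Whiteman.D₀ n₁ n₂ g u) 1 = 0 then
            Whiteman.rootPoly β (Whiteman.D₀ n₁ n₂ g u) else 1) *
          (if Whiteman.expSum β (Whiteman.D₁ n₁ n₂ g u) 1 = 0 then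
            Whiteman.rootPoly β (Whiteman.D₁ n₁ n₂ g u) else 1)) = d ∧ d ≠ 0 ∧
        d.natDegree = (n₁ - 1) / 2 * (n₂ - 1) ∧ (Lb = 0 → d = d₀) ∧ (Lb = -1 → d = d₁) := by
      rcases mul_eq_zero.1 hη with h0 | h0
      · rw [h0, zero_add] at hadd
        rw [h0, neg_zero] at hLb'
        refine ⟨Or.inl hLb', d₀, ?_, ?_, ?_, fun _ => rfl, fun h => ?_⟩
        · rw [if_pos h0, if_neg (by rw [hadd]; exact one_ne_zero), mul_one, hd₀]
        · rw [hd₀]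
          exact (rootPoly_monic _).ne_zero
        · rw [hd₀, natDegree_rootPoly, hs.card_D₀]
        · rw [hLb', eq_comm, neg_eq_zero] at h
          exact absurd h one_ne_zero
      · rw [h0, add_zero] at hadd
        rw [hadd] at hLb'
        refine ⟨Or.inr hLb', d₁, ?_, ?_, ?_, fun h => ?_, fun _ => rfl⟩
        · rw [if_pos h0, if_neg (by rw [hadd]; exact one_ne_zero), one_mul, hd₁]
        · rw [hd₁]
          exact (rootPoly_monic _).ne_zero
        · rw [hd₁, natDegree_rootPoly, hs.card_D₁]
        · rw [hLb', neg_eq_zero] at h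
          exact absurd h one_ne_zero
    refine ⟨hq, hlift.1, hlift.2, hLb01, ?_⟩
    rw [hdeq] at hE
    obtain ⟨t1, t2, t3, t4, t5⟩ := Whiteman.isQuotient_table hN hn₁.ne_zero hn₂.ne_zero hdne
      h₁ h₂ (hs.rootPoly_P_mul hβ) (hs.rootPoly_ker₂_erase_mul hβ) hE
    simp only [natDegree_map] at t1 t2 t3 t4 t5
    have hM : (d.natDegree : ℚ) = (n₁ - 1) * (n₂ - 1) / 2 := by
      have h3 := congrArg (Nat.cast (R := ℚ)) hhalf₁
      have h4 : ((n₂ - 1 : ℕ) : ℚ) = n₂ - 1 := Nat.cast_pred hn₂.pos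
      rw [Nat.cast_add, Nat.cast_mul, Nat.cast_ofNat, Nat.cast_one] at h3
      rw [hdeg, Nat.cast_mul, h4]
      linear_combination ((n₂ : ℚ) - 1) / 2 * h3
    refine ⟨fun a₁ a₂ a => ?_, fun a₁ a₂ a => ?_, fun a₁ a₂ => ?_, fun a₁ a₂ => ?_,
      fun a₁ a₂ => ?_⟩
    · obtain ⟨hQ, hL⟩ := t1 a₁ a₂ a
      refine ⟨fun h => hLb0 h ▸ hQ, fun h => hLb1 h ▸ hQ, ?_⟩
      have hL' := congrArg (Nat.cast (R := ℚ)) hL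
      push_cast at hL' ⊢
      linear_combination hL' - hM
    · obtain ⟨hQ, hL⟩ := t2 a₁ a₂ a
      refine ⟨fun h => hLb0 h ▸ hQ, fun h => hLb1 h ▸ hQ, ?_⟩
      have hL' := congrArg (Nat.cast (R := ℚ)) hL
      push_cast at hL' ⊢
      linear_combination hL' - hM
    · obtain ⟨hQ, hL⟩ := t3 a₁ a₂
      refine ⟨fun h => hLb0 h ▸ hQ, fun h => hLb1 h ▸ hQ, ?_⟩
      have hL' := congrArg (Nat.cast (R := ℚ)) hL
      push_cast at hL' ⊢
      linear_combination hL' - hM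
    · obtain ⟨hQ, hL⟩ := t4 a₁ a₂
      refine ⟨fun h => hLb0 h ▸ hQ, fun h => hLb1 h ▸ hQ, ?_⟩
      have hL' := congrArg (Nat.cast (R := ℚ)) hL
      push_cast at hL' ⊢
      linear_combination hL' - hM
    · obtain ⟨hQ, hL⟩ := t5 a₁ a₂
      refine ⟨fun h => hLb0 h ▸ hQ, fun h => hLb1 h ▸ hQ, ?_⟩
      have hL' := congrArg (Nat.cast (R := ℚ)) hL
      push_cast at hL' ⊢
      linear_combination hL' - hM
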